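/- A Polish group $G$ is \emph{TSI} if it admits a compatible two-sided invariant metric. It is \emph{strongly NSS} if there is an open set $V\ni 1_G$ such that for every sequence $(g_n)_{n\in\omega}$ in $G$ that does not converge to $1_G$ there are indices $n_0<\dots<n_k$ with $g_{n_0}\cdots g_{n_k}\notin V$. For a Polish group $G$, let $E(G)$ be the equivalence relation on $G^\omega$ given by $x\,E(G)\,y$ iff $x(n)y(n)^{-1}$ converges in $G$ as $n\to\infty$. For equivalence relations $E$, $F$ on Polish spaces $X$, $Y$, $E$ is \emph{Borel reducible} to $F$, written $E\le_B F$, if there is a Borel map $f:X\to Y$ such that $x\,E\,y\iff f(x)\,F\,f(y)$ for all $x,y\in X$. \textbf{Corollary.} Let $G$ be a TSI Polish group and let $H$ be a closed subgroup of the product of a countable family of TSI strongly NSS Polish groups. If $H$ is totally disconnected but $G$ is not, then $E(G)\not\le_B E(H)$. -/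

import Mathlib

open Filter Topology

/-- A topological group is TSI if it admits a compatible two-sided invariant metric: a metric that
induces the given topology and is both left- and right-invariant. -/
def IsTSI (G : Type*) [Group G] [t : TopologicalSpace G] : Prop :=
  ∃ m : MetricSpace G, m.toPseudoMetricSpace.toUniformSpace.toTopologicalSpace = t ∧
    (∀ g h k : G, m.dist (g * h) (g * k) = m.dist h k) ∧
    (∀ g h k : G, m.dist (h * g) (k * g) = m.dist h k)

/-- An open neighbourhood `V` of `1` is an unenclosed set if for every sequence `g` that does not
converge to `1` there are indices `n₀ < ⋯ < nₖ` (the entries of the list `l`, in order) with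
`g n₀ * ⋯ * g nₖ ∉ V`. -/
def IsUnenclosed {G : Type*} [Group G] [TopologicalSpace G] (V : Set G) : Prop :=
  IsOpen V ∧ (1 : G) ∈ V ∧
    ∀ g : ℕ → G, ¬ Tendsto g atTop (𝓝 1) →
      ∃ l : List ℕ, l ≠ [] ∧ l.Pairwise (· < ·) ∧ (l.map g).prod ∉ V

/-- A topological group is strongly NSS if it has an unenclosed set. -/
def IsStronglyNSS (G : Type*) [Group G] [TopologicalSpace G] : Prop :=
  ∃ V : Set G, IsUnenclosed V

/-- The equivalence relation `E(G)` on `G^ω`: the sequences `x`, `y` are equivalent if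
`x n * (y n)⁻¹` converges in `G`. -/
def inducedEquiv (G : Type*) [Group G] [TopologicalSpace G] [IsTopologicalGroup G] :
    Setoid (ℕ → G) where
  r x y := ∃ a : G, Tendsto (fun n => x n * (y n)⁻¹) atTop (𝓝 a)
  iseqv :=
    { refl := fun x => ⟨1, by simpa using tendsto_const_nhds⟩
      symm := by
        rintro x y ⟨a, ha⟩
        exact ⟨a⁻¹, by simpa using ha.inv⟩
      trans := by
        rintro x y z ⟨a, ha⟩ ⟨b, hb⟩
        exact ⟨a * b, by simpa using ha.mul hb⟩ }

/-- `E ≤_B F`: there is a Borel map `f` with `E x y ↔ F (f x) (f y)`. -/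
def BorelReducible {X Y : Type*} [TopologicalSpace X] [TopologicalSpace Y]
    (E : Setoid X) (F : Setoid Y) : Prop :=
  ∃ f : X → Y, @Measurable X Y (borel X) (borel Y) f ∧ ∀ x y : X, E x y ↔ F (f x) (f y)

/-! Replacing `G` by its identity component, one may assume that `G` is connected and nontrivial.
Two-sided invariant metrics on Polish groups are complete (`completeSpace_of_biInvariant`), so
convergence can be tested by Cauchy estimates.

Let a countable group `D` map densely to `G`, and describe sequences in `G` by increments taken from
finite sets `F j` that eventually contain each element of `D`. A Borel reduction is continuous on a
comeagre set. Stitching along a generic point and rearranging the output turns it into a reduction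
of increments that acts block by block: the increment `g` at place `j` contributes a fixed block `τ
j g` with total displacement `σ j g` (`exists_stitched`, `nonempty_blockReduction`).

Gluing counterexamples shows that such a reduction is uniformly continuous
(`exists_forall_dist_val_le`). In a strongly NSS quotient of `H` more is true: two inputs whose
quotient stays within a fixed `δ` of its starting value and returns to it have outputs whose
quotient also almost returns (`exists_forall_dist_prod_lt`). Comparing the increments `g`, `h` at
separate places with the single increment `g * h` shows that the images of `σ p g` converge as `p →
∞`. The limits assemble to a continuous map from `G` to `H`, which is constant since `G` is
connected and `H` totally disconnected. Hence `σ p g → 1` for every `g` (`tendsto_σ_one`).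

This is absurd. Fix `g` with nontrivial image in `G`, factor it into small elements, and place the
factors so far out that the displacements in `H` are summable. Repeating this forever gives a
sequence with convergent output whose partial products in `G` jump by `g` in every block
(`exists_not_tendsto_σ_one`). -/

set_option linter.unusedSectionVars false

/-! ### Two-sided invariant metrics and their completeness. -/

section BiInvariant

variable {G : Type*} [Group G] [MetricSpace G] [IsIsometricSMul G G] [IsIsometricSMul Gᵐᵒᵖ G]

theorem dist_mul_inv_mul_inv (a b c d : G) :
    dist (a * b⁻¹) (c * d⁻¹) = dist (c⁻¹ * a) (d⁻¹ * b) := by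
  rw [← dist_mul_left c⁻¹, ← dist_mul_right _ _ b]
  simp [mul_assoc]

theorem dist_mul_inv_one (a b : G) : dist (a * b⁻¹) 1 = dist a b := by
  rw [← dist_mul_right _ _ b]
  simp

theorem dist_mul_left_self (a b : G) : dist (a * b) a = dist b 1 := by
  simpa using dist_mul_left a b 1

theorem dist_mul_right_self (a b : G) : dist (b * a) a = dist b 1 := by
  simpa using dist_mul_right b 1 a

theorem dist_mul_mul_le_add (a b c d : G) : dist (a * b) (c * d) ≤ dist a c + dist b d := by
  refine (dist_triangle _ (c * b) _).trans_eq ?_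
  rw [dist_mul_right, dist_mul_left]

theorem dist_mul_inv_mul_inv_le (a b c d : G) :
    dist (a * b⁻¹) (c * d⁻¹) ≤ dist a c + dist b d := by
  simpa using dist_mul_mul_le_add a b⁻¹ c d⁻¹

/-- A compatible two-sided invariant metric on a Polish group is complete. -/
theorem completeSpace_of_biInvariant [IsTopologicalGroup G] [PolishSpace G] :
    CompleteSpace G := by
  obtain ⟨Y, mY, cY, ⟨e⟩⟩ : ∃ (Y : Type _) (_ : MetricSpace Y) (_ : CompleteSpace Y),
      Nonempty (G ≃ₜ Y) := by
    obtain ⟨m, hm, hc⟩ := (inferInstance : TopologicalSpace.IsCompletelyMetrizableSpace G).complete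
    exact ⟨G, m, hc, ⟨hm ▸ @Homeomorph.refl G _⟩⟩
  refine Metric.complete_of_cauchySeq_tendsto fun g hg => ?_
  rw [Metric.cauchySeq_iff] at hg
  -- The metric of `Y` is complete but has no invariance. By Baire category some right translate of
  -- `g` is Cauchy for it.
  let O : ℕ → Set G := fun k => {x | ∃ δ > 0, ∃ N, ∀ n ≥ N, ∀ n' ≥ N, ∀ y y',
    dist y (g n * x) < δ → dist y' (g n' * x) < δ → dist (e y) (e y') < 1 / ((k : ℝ) + 1)}
  have hO : ∀ k, IsOpen (O k) := by
    intro k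
    rw [Metric.isOpen_iff]
    rintro x ⟨δ, hδ, N, h⟩
    refine ⟨δ / 2, by positivity, fun x' hx' => ⟨δ / 2, by positivity, N, ?_⟩⟩
    have key : ∀ n y, dist y (g n * x') < δ / 2 → dist y (g n * x) < δ := by
      intro n y hy
      have h1 := dist_triangle y (g n * x') (g n * x)
      rw [dist_mul_left] at h1
      rw [Metric.mem_ball] at hx'
      linarith
    exact fun n hn n' hn' y y' hy hy' => h n hn n' hn' y y' (key n y hy) (key n' y' hy')
  have hD : ∀ k, Dense (O k) := by
    intro k
    rw [Metric.dense_iff]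
    intro x r hr
    obtain ⟨N, hN⟩ := hg r hr
    obtain ⟨ρ, hρ, hρe⟩ := Metric.continuousAt_iff.1 (e.continuous.continuousAt (x := g N * x))
      (1 / ((k : ℝ) + 1) / 2) (by positivity)
    obtain ⟨M', hM'⟩ := hg (ρ / 2) (by positivity)
    set M := max M' N with hM
    -- For large `n`, `g n` carries this point close to the fixed point `g N * x`, where `e` is
    -- continuous.
    refine ⟨(g M)⁻¹ * (g N * x), ?_, ρ / 2, by positivity, M, ?_⟩
    · rw [Metric.mem_ball, ← dist_mul_left (g M), mul_inv_cancel_left, dist_mul_right]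
      exact hN N le_rfl M (le_max_right _ _)
    · have key : ∀ n ≥ M, ∀ y, dist y (g n * ((g M)⁻¹ * (g N * x))) < ρ / 2 →
          dist (e y) (e (g N * x)) < 1 / ((k : ℝ) + 1) / 2 := by
        intro n hn y hy
        apply hρe
        have h1 := dist_triangle y (g n * ((g M)⁻¹ * (g N * x))) (g N * x)
        have h2 : dist (g n * ((g M)⁻¹ * (g N * x))) (g N * x) = dist (g n) (g M) := by
          rw [← mul_assoc, dist_mul_right_self, dist_mul_inv_one]
        have h3 := hM' n ((le_max_left _ _).trans hn) M (le_max_left _ _)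
        linarith
      intro n hn n' hn' y y' hy hy'
      have h1 := key n hn y hy
      have h2 := key n' hn' y' hy'
      have h3 := dist_triangle_right (e y) (e y') (e (g N * x))
      linarith
  obtain ⟨x, hx⟩ := (dense_iInter_of_isOpen hO hD).nonempty
  rw [Set.mem_iInter] at hx
  have hc : CauchySeq fun n => e (g n * x) := by
    rw [Metric.cauchySeq_iff]
    intro ε hε
    obtain ⟨k, hk⟩ := exists_nat_one_div_lt hε
    obtain ⟨δ, hδ, N, h⟩ := hx k
    exact ⟨N, fun n hn n' hn' => (h n hn n' hn' _ _ (by simpa) (by simpa)).trans hk⟩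
  obtain ⟨z, hz⟩ := cauchySeq_tendsto_of_complete hc
  refine ⟨e.symm z * x⁻¹, ?_⟩
  simpa using ((e.symm.continuous.tendsto z).comp hz).mul_const x⁻¹

end BiInvariant

/-! ### Partial products and gluing of finite blocks. -/

section SeqProd

/-- The product `u 0 * ⋯ * u (n - 1)` of the first `n` terms of a sequence in a monoid. -/
def seqProd {M : Type*} [Monoid M] (u : ℕ → M) : ℕ → M
  | 0 => 1
  | n + 1 => seqProd u n * u n

@[simp] theorem seqProd_zero {M : Type*} [Monoid M] (u : ℕ → M) : seqProd u 0 = 1 := rfl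

theorem seqProd_succ {M : Type*} [Monoid M] (u : ℕ → M) (n : ℕ) :
    seqProd u (n + 1) = seqProd u n * u n := rfl

theorem map_seqProd {M N : Type*} [Monoid M] [Monoid N] (f : M →* N) (u : ℕ → M) (n : ℕ) :
    f (seqProd u n) = seqProd (fun k => f (u k)) n := by
  induction n with
  | zero => simp
  | succ n ih => simp [seqProd_succ, ih]

theorem seqProd_congr {M : Type*} [Monoid M] {u v : ℕ → M} {n : ℕ} (h : ∀ k < n, u k = v k) :
    seqProd u n = seqProd v n := by
  induction n with
  | zero => rfl
  | succ n ih => rw [seqProd_succ, seqProd_succ, ih fun k hk => h k (by omega), h n (by omega)]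

theorem seqProd_eq_of_eq_one {M : Type*} [Monoid M] {u : ℕ → M} {N n : ℕ} (hn : N ≤ n)
    (h : ∀ k, N ≤ k → k < n → u k = 1) : seqProd u n = seqProd u N := by
  induction n, hn using Nat.le_induction with
  | base => rfl
  | succ n hn ih =>
    rw [seqProd_succ, ih fun k hk hk' => h k hk (by omega), h n hn (by omega), mul_one]

theorem seqProd_inv_mul_congr {M : Type*} [Group M] {u v : ℕ → M} {N n : ℕ} (hn : N ≤ n)
    (h : ∀ k, N ≤ k → k < n → u k = v k) :
    (seqProd u N)⁻¹ * seqProd u n = (seqProd v N)⁻¹ * seqProd v n := by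
  induction n, hn using Nat.le_induction with
  | base => simp
  | succ n hn ih =>
    rw [seqProd_succ, seqProd_succ, ← mul_assoc, ← mul_assoc,
      ih fun k hk hk' => h k hk (by omega), h n hn (by omega)]

end SeqProd

section Gluing

/-- The index `k` of the block `[N k, N (k + 1))` that contains `n`. -/
def blockIndex (N : ℕ → ℕ) (n : ℕ) : ℕ := Nat.findGreatest (fun k => N k ≤ n) n

theorem le_blockIndex {N : ℕ → ℕ} (hN : StrictMono N) {k n : ℕ} (h : N k ≤ n) :
    k ≤ blockIndex N n :=
  Nat.le_findGreatest (P := fun k => N k ≤ n) ((hN.id_le k).trans h) h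

theorem blockIndex_eq {N : ℕ → ℕ} (hN : StrictMono N) {k n : ℕ} (h : N k ≤ n)
    (h' : n < N (k + 1)) : blockIndex N n = k := by
  refine le_antisymm ?_ (le_blockIndex hN h)
  by_contra! hlt
  have h1 : N (blockIndex N n) ≤ n :=
    Nat.findGreatest_spec (P := fun k => N k ≤ n) (m := k) ((hN.id_le k).trans h) h
  have h2 : N (k + 1) ≤ N (blockIndex N n) := hN.monotone hlt
  omega

theorem exists_block {N : ℕ → ℕ} (hN : StrictMono N) {n : ℕ} (h : N 0 ≤ n) :
    N (blockIndex N n) ≤ n ∧ n < N (blockIndex N n + 1) := by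
  refine ⟨Nat.findGreatest_spec (P := fun k => N k ≤ n) (m := 0) (Nat.zero_le _) h, ?_⟩
  by_contra! hle
  have := le_blockIndex hN hle
  omega

/-- Finite blocks with prescribed properties can be glued to a sequence. -/
theorem exists_glued {α : Type*} (a₀ : α) (Q : ℕ → ℕ → ℕ → (ℕ → α) → Prop)
    (hQ : ∀ k N M u v, (∀ i, N ≤ i → i < M → u i = v i) → Q k N M u → Q k N M v)
    (h : ∀ k N, ∃ M > N, ∃ u, Q k N M u) (N₀ : ℕ) :
    ∃ N : ℕ → ℕ, StrictMono N ∧ N 0 = N₀ ∧ ∃ u : ℕ → α, (∀ n < N₀, u n = a₀) ∧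
      ∀ k, Q k (N k) (N (k + 1)) u := by
  choose M hM v hv using h
  let N : ℕ → ℕ := fun k => Nat.rec N₀ (fun k n => M k n) k
  have hs : ∀ k, N (k + 1) = M k (N k) := fun k => rfl
  have hN : StrictMono N := strictMono_nat_of_lt_succ fun k => by rw [hs]; exact hM _ _
  refine ⟨N, hN, rfl, fun n => if n < N₀ then a₀ else v (blockIndex N n) (N (blockIndex N n)) n,
    fun n hn => if_pos hn, fun k => ?_⟩
  refine hQ _ _ _ (v k (N k)) _ (fun i hi hi' => ?_) (by rw [hs]; exact hv _ _)
  have h0 : N 0 ≤ N k := hN.monotone (Nat.zero_le k)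
  have h1 : ¬ i < N₀ := by
    have : N 0 = N₀ := rfl
    omega
  simp only [h1, if_false, blockIndex_eq hN hi hi']

end Gluing

/-! ### Generic continuity of Borel maps on sequences. -/

section Generic

/-- The sequences with values in `E` that are constant from `n` on. -/
def eventuallyConst {D : Type*} (E : Set D) (n : ℕ) : Set (ℕ → D) :=
  {γ | (∀ k, γ k ∈ E) ∧ ∀ k ≥ n, γ k = γ n}

theorem finite_eventuallyConst {D : Type*} {E : Set D} (hE : E.Finite) (n : ℕ) :
    (eventuallyConst E n).Finite := by
  refine Set.Finite.of_finite_image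
    (f := fun (γ : ℕ → D) (i : Fin (n + 1)) => γ i) ?_ ?_
  · refine (Set.Finite.pi' (t := fun _ : Fin (n + 1) => E) fun _ => hE).subset ?_
    rintro _ ⟨γ, hγ, rfl⟩ i
    exact hγ.1 i
  · intro γ hγ γ' hγ' h
    have h1 : ∀ k ≤ n, γ k = γ' k := fun k hk => congrFun h ⟨k, by omega⟩
    funext k
    rcases le_total k n with hk | hk
    · exact h1 k hk
    · rw [hγ.2 k hk, hγ'.2 k hk, h1 n le_rfl]

theorem countable_eventuallyConst {D : Type*} [Countable D] :
    {γ : ℕ → D | ∃ n, γ ∈ eventuallyConst Set.univ n}.Countable := by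
  refine (Set.countable_range fun p : List D × D => fun n => p.1.getD n p.2).mono ?_
  rintro γ ⟨n, -, hγ⟩
  refine ⟨((List.range n).map γ, γ n), ?_⟩
  funext k
  by_cases hk : k < n
  · simp [List.getD, hk]
  · have h1 := hγ k (by omega)
    simp [List.getD, hk, h1]

theorem mul_mem_eventuallyConst {D : Type*} [Mul D] {γ γ' : ℕ → D} {n n' : ℕ}
    (h : γ ∈ eventuallyConst Set.univ n) (h' : γ' ∈ eventuallyConst Set.univ n') :
    γ * γ' ∈ eventuallyConst Set.univ (max n n') := by
  refine ⟨fun _ => trivial, fun k hk => ?_⟩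
  have h1 : n ≤ max n n' := le_max_left _ _
  have h2 : n' ≤ max n n' := le_max_right _ _
  rw [Pi.mul_apply, Pi.mul_apply, h.2 k (h1.trans hk), h'.2 k (h2.trans hk), h.2 _ h1, h'.2 _ h2]

variable {D : Type*} [TopologicalSpace D] [DiscreteTopology D]

theorem isOpen_cylinder (x : ℕ → D) (n : ℕ) : IsOpen {y : ℕ → D | ∀ k < n, y k = x k} := by
  have : {y : ℕ → D | ∀ k < n, y k = x k} = (Set.Iio n).pi fun k => {x k} := by
    ext y
    simp [Set.mem_pi]
  rw [this]
  exact isOpen_set_pi (Set.finite_Iio n) fun _ _ => isOpen_discrete _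

theorem eventually_cylinder_subset {x : ℕ → D} {s : Set (ℕ → D)} (hs : s ∈ 𝓝 x) :
    ∀ᶠ n in atTop, ∀ y : ℕ → D, (∀ k < n, y k = x k) → y ∈ s := by
  rw [nhds_pi, Filter.mem_pi] at hs
  obtain ⟨I, hI, t, ht, hts⟩ := hs
  obtain ⟨b, hb⟩ := hI.bddAbove
  refine (eventually_gt_atTop b).mono fun n hn y hy => hts fun i hi => ?_
  rw [hy i ((hb hi).trans_lt hn)]
  exact mem_of_mem_nhds (ht i)

/-- A Borel map on `D^ω`, for `D` a countable discrete group, is continuous on a dense `Gδ` set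
invariant under translations by eventually constant sequences. -/
theorem exists_generic [Countable D] [Group D] {Z : Type*} [TopologicalSpace Z]
    [SecondCountableTopology Z] (φ : (ℕ → D) → Z) (hφ : @Measurable _ _ (borel _) (borel _) φ) :
    ∃ C : Set (ℕ → D), IsGδ C ∧ Dense C ∧ ContinuousOn φ C ∧
      ∀ n, ∀ γ ∈ eventuallyConst (Set.univ : Set D) n, ∀ v ∈ C, γ * v ∈ C := by
  let _ : MeasurableSpace (ℕ → D) := borel _
  have _ : BorelSpace (ℕ → D) := ⟨rfl⟩
  let _ : MeasurableSpace Z := borel _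
  have _ : BorelSpace Z := ⟨rfl⟩
  have hφ' : Measurable φ := hφ
  have h1 : ∀ b ∈ TopologicalSpace.countableBasis Z, ∃ u : Set (ℕ → D), IsOpen u ∧
      φ ⁻¹' b =ᶠ[residual _] u := fun b hb =>
    (hφ' (TopologicalSpace.isOpen_of_mem_countableBasis hb).measurableSet).residualEq_isOpen
  choose! u hu hu' using h1
  have hR : {x | ∀ b ∈ TopologicalSpace.countableBasis Z, (x ∈ φ ⁻¹' b ↔ x ∈ u b)} ∈
      residual (ℕ → D) := by
    refine (eventually_countable_ball (TopologicalSpace.countable_countableBasis Z)).2 ?_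
    intro b hb
    exact (hu' b hb).mem_iff
  obtain ⟨t, htR, htG, htD⟩ := mem_residual.1 hR
  let S : Set (ℕ → D) := {γ | ∃ n, γ ∈ eventuallyConst Set.univ n}
  have hS : S.Countable := countable_eventuallyConst
  have hhomeo : ∀ γ : ℕ → D, IsOpenMap (fun v : ℕ → D => γ * v) ∧
      Continuous fun v : ℕ → D => γ * v :=
    fun γ => ⟨(Homeomorph.mulLeft γ).isOpenMap, (Homeomorph.mulLeft γ).continuous⟩
  -- Intersecting over the countable set `S`, which is closed under products, makes the comeagre set
  -- invariant.
  refine ⟨⋂ γ ∈ S, (fun v => γ * v) ⁻¹' t, ?_, ?_, ?_, ?_⟩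
  · exact IsGδ.biInter hS fun γ _ => htG.preimage (hhomeo γ).2
  · exact dense_biInter_of_Gδ (fun γ _ => htG.preimage (hhomeo γ).2) hS
      fun γ _ => htD.preimage (hhomeo γ).1
  · have hsub : (⋂ γ ∈ S, (fun v => γ * v) ⁻¹' t) ⊆ t := by
      intro v hv
      have := Set.mem_iInter₂.1 hv 1 ⟨0, fun _ => trivial, fun _ _ => rfl⟩
      simpa using this
    refine ContinuousOn.mono ?_ hsub
    intro x hx
    rw [ContinuousWithinAt, (TopologicalSpace.isBasis_countableBasis Z).nhds_hasBasis.tendsto_right_iff]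
    rintro b ⟨hb, hxb⟩
    have hxu : x ∈ u b := (htR hx b hb).1 hxb
    filter_upwards [mem_nhdsWithin_of_mem_nhds ((hu b hb).mem_nhds hxu), self_mem_nhdsWithin]
      with y hy hyt
    exact (htR hyt b hb).2 hy
  · intro n γ hγ v hv
    refine Set.mem_iInter₂.2 fun γ' hγ' => ?_
    obtain ⟨n', hn'⟩ := hγ'
    have := Set.mem_iInter₂.1 hv (γ' * γ) ⟨_, mul_mem_eventuallyConst hn' hγ⟩
    simpa [mul_assoc] using this

variable {H : Type*} [Group H] [MetricSpace H] [IsTopologicalGroup H]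

/-- One step of the stitching construction. -/
theorem exists_stitch_step [Countable D] [Group D] {φ : (ℕ → D) → ℕ → H} {C : Set (ℕ → D)}
    (hCG : IsGδ C) (hCD : Dense C) (hφC : ContinuousOn φ C)
    (hCinv : ∀ n, ∀ γ ∈ eventuallyConst (Set.univ : Set D) n, ∀ v ∈ C, γ * v ∈ C)
    (hφ : ∀ n, ∀ γ ∈ eventuallyConst (Set.univ : Set D) n,
      ∀ γ' ∈ eventuallyConst (Set.univ : Set D) n, ∀ v,
        ∃ a : H, Tendsto (fun l => φ (γ * v) l * (φ (γ' * v) l)⁻¹) atTop (𝓝 a))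
    {E : Set D} (hE : E.Finite) {O : Set (ℕ → D)} (hO : IsOpen O) (hCO : C ⊆ O) {ε : ℝ}
    (hε : 0 < ε) (n m : ℕ) (z : ℕ → D) :
    ∃ n' > n, ∃ m' > m, ∃ z' : ℕ → D, (∀ k < n, z' k = z k) ∧
      (∀ γ ∈ eventuallyConst E n, ∀ x : ℕ → D, (∀ k < n', x k = γ k * z' k) → x ∈ O) ∧
      (∀ γ ∈ eventuallyConst E n, ∀ γ' ∈ eventuallyConst E n, ∀ v ∈ C, (∀ k < n', v k = z' k) →
        ∀ l ≥ m', ∀ l' ≥ m', dist (φ (γ * v) l * (φ (γ' * v) l)⁻¹)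
          (φ (γ * v) l' * (φ (γ' * v) l')⁻¹) ≤ ε) ∧
      (∀ γ ∈ eventuallyConst E n, ∀ v ∈ C, ∀ v' ∈ C, (∀ k < n', v k = γ k * z' k) →
        (∀ k < n', v' k = γ k * z' k) → ∀ l ≤ m', dist (φ v l) (φ v' l) ≤ ε) := by
  have hmono : ∀ γ ∈ eventuallyConst E n, γ ∈ eventuallyConst (Set.univ : Set D) n :=
    fun γ hγ => ⟨fun _ => trivial, hγ.2⟩
  have hfin := finite_eventuallyConst hE n
  -- As there are finitely many `γ`, `γ'`, these sets cover `C`. Baire category makes one of them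
  -- somewhere dense, and continuity on `C` then carries its estimate to all nearby points of `C`.
  let B : ℕ → Set (ℕ → D) := fun M => {v | v ∈ C ∧ ∀ γ ∈ eventuallyConst E n,
    ∀ γ' ∈ eventuallyConst E n, ∀ l ≥ M, ∀ l' ≥ M, dist (φ (γ * v) l * (φ (γ' * v) l)⁻¹)
          (φ (γ * v) l' * (φ (γ' * v) l')⁻¹) ≤ ε}
  have hcover : C ⊆ ⋃ M, closure (B M) := by
    intro v hv
    have h1 : ∀ᶠ M in atTop, ∀ γ ∈ eventuallyConst E n, ∀ γ' ∈ eventuallyConst E n, ∀ l ≥ M,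
        ∀ l' ≥ M, dist (φ (γ * v) l * (φ (γ' * v) l)⁻¹)
          (φ (γ * v) l' * (φ (γ' * v) l')⁻¹) ≤ ε := by
      refine (eventually_all_finite hfin).2 fun γ hγ =>
        (eventually_all_finite hfin).2 fun γ' hγ' => ?_
      obtain ⟨a, ha⟩ := hφ n γ (hmono γ hγ) γ' (hmono γ' hγ') v
      obtain ⟨M, hM⟩ := Metric.cauchySeq_iff.1 ha.cauchySeq ε hε
      filter_upwards [eventually_ge_atTop M] with M' hM' l hl l' hl'
      exact (hM l (hM'.trans hl) l' (hM'.trans hl')).le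
    obtain ⟨M, hM⟩ := h1.exists
    exact Set.mem_iUnion.2 ⟨M, subset_closure ⟨hv, hM⟩⟩
  have hdense := hCG.dense_iUnion_interior_of_closed hCD (fun M => isClosed_closure) hcover
  obtain ⟨w, hwU, hw⟩ := hdense.inter_open_nonempty _ (isOpen_cylinder z n) ⟨z, fun _ _ => rfl⟩
  obtain ⟨M, hM⟩ := Set.mem_iUnion.1 hw
  obtain ⟨v₀, ⟨hv₀U, hv₀M⟩, hv₀C⟩ := hCD.inter_open_nonempty _
    ((isOpen_cylinder z n).inter isOpen_interior) ⟨w, hwU, hM⟩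
  have hlim : ∀ v ∈ C, v ∈ closure (B M) → v ∈ B M := by
    intro v hv hvB
    refine ⟨hv, fun γ hγ γ' hγ' l hl l' hl' => ?_⟩
    have := mem_closure_iff_nhdsWithin_neBot.1 hvB
    have hc : ∀ γ ∈ eventuallyConst E n, ∀ l,
        Tendsto (fun v => φ (γ * v) l) (𝓝[B M] v) (𝓝 (φ (γ * v) l)) := by
      intro γ hγ l
      have h1 : ContinuousOn (fun v => φ (γ * v)) C :=
        hφC.comp (continuous_const.mul continuous_id).continuousOn
          fun v hv => hCinv n γ (hmono γ hγ) v hv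
      exact ((continuous_apply l).tendsto _).comp ((h1 v hv).mono fun x hx => hx.1)
    refine le_of_tendsto (((hc γ hγ l).mul (hc γ' hγ' l).inv).dist
      ((hc γ hγ l').mul (hc γ' hγ' l').inv)) ?_
    filter_upwards [self_mem_nhdsWithin] with x hx
    exact hx.2 γ hγ γ' hγ' l hl l' hl'
  -- `m'` is fixed before `n'`, since the cylinder must be long enough to control the output up to
  -- `m'`.
  set m' := max M (m + 1) with hm'
  have e1 := eventually_cylinder_subset (isOpen_interior.mem_nhds hv₀M)
  have e2 : ∀ᶠ n' in atTop, ∀ γ ∈ eventuallyConst E n, ∀ y : ℕ → D,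
      (∀ k < n', y k = (γ * v₀) k) → y ∈ O :=
    (eventually_all_finite hfin).2 fun γ hγ => eventually_cylinder_subset
      (hO.mem_nhds (hCO (hCinv n γ (hmono γ hγ) v₀ hv₀C)))
  have e3 : ∀ᶠ n' in atTop, ∀ γ ∈ eventuallyConst E n, ∀ y : ℕ → D,
      (∀ k < n', y k = (γ * v₀) k) →
        y ∈ {y | y ∈ C → ∀ l ≤ m', dist (φ y l) (φ (γ * v₀) l) < ε / 2} := by
    refine (eventually_all_finite hfin).2 fun γ hγ => eventually_cylinder_subset ?_
    have hc := hφC (γ * v₀) (hCinv n γ (hmono γ hγ) v₀ hv₀C)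
    rw [ContinuousWithinAt, tendsto_pi_nhds] at hc
    have : ∀ᶠ y in 𝓝[C] (γ * v₀), ∀ l ∈ Set.Iic m', dist (φ y l) (φ (γ * v₀) l) < ε / 2 :=
      (eventually_all_finite (Set.finite_Iic m')).2 fun l _ =>
        Metric.tendsto_nhds.1 (hc l) (ε / 2) (by positivity)
    rw [eventually_nhdsWithin_iff] at this
    exact this
  obtain ⟨n', h1, h2, h3, h4⟩ := (e1.and (e2.and (e3.and (eventually_gt_atTop n)))).exists
  refine ⟨n', h4, m', by omega, v₀, hv₀U, h2, ?_, ?_⟩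
  · intro γ hγ γ' hγ' v hv hvz l hl l' hl'
    exact (hlim v hv (interior_subset (h1 v hvz))).2 γ hγ γ' hγ' l (by omega) l' (by omega)
  · intro γ hγ v hv v' hv' hvz hvz' l hl
    have a1 := h3 γ hγ v hvz hv l hl
    have a2 := h3 γ hγ v' hvz' hv' l hl
    have a3 := dist_triangle_right (φ v l) (φ v' l) (φ (γ * v₀) l)
    linarith

end Generic

/-! ### Stitching a reduction along a generic point. -/

section Stitching

theorem seqProd_eq_mul {M : Type*} [Monoid M] (u : ℕ → M) (j n : ℕ) :
    seqProd u n = seqProd u (min n j) * seqProd (fun k => if k < j then 1 else u k) n := by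
  have hone : ∀ n ≤ j, seqProd (fun k => if k < j then 1 else u k) n = 1 := fun n hn =>
    seqProd_eq_of_eq_one (Nat.zero_le n) fun k _ hk => if_pos (by omega)
  rcases le_total n j with h | h
  · rw [min_eq_left h, hone n h, mul_one]
  · rw [min_eq_right h]
    induction n, h using Nat.le_induction with
    | base => rw [hone j le_rfl, mul_one]
    | succ n hn ih => rw [seqProd_succ, seqProd_succ, ih, mul_assoc, if_neg (by omega)]

theorem finite_seqProd {D : Type*} [Monoid D] {F : ℕ → Set D} (hF : ∀ j, (F j).Finite) (n : ℕ) :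
    {d | ∃ u : ℕ → D, (∀ j, u j ∈ F j) ∧ d = seqProd u n}.Finite := by
  induction n with
  | zero =>
    refine (Set.finite_singleton (1 : D)).subset ?_
    rintro _ ⟨u, -, rfl⟩
    rfl
  | succ n ih =>
    refine (Set.Finite.image2 (· * ·) ih (hF n)).subset ?_
    rintro _ ⟨u, hu, rfl⟩
    exact ⟨_, ⟨u, hu, rfl⟩, _, hu n, rfl⟩

/-- The sequence of quotients `(u 0 * ⋯ * u (n - 1)) * (v 0 * ⋯ * v (n - 1))⁻¹`. -/
def quotProd {G : Type*} [Group G] (u v : ℕ → G) (n : ℕ) : G := seqProd u n * (seqProd v n)⁻¹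

theorem exists_seq_of_step {α : Type*} (R : ℕ → α → α → Prop) (h : ∀ j a, ∃ b, R j a b) (a₀ : α) :
    ∃ s : ℕ → α, s 0 = a₀ ∧ ∀ j, R j (s j) (s (j + 1)) := by
  choose g hg using h
  exact ⟨fun n => Nat.rec a₀ g n, rfl, fun j => hg j _⟩

variable {G : Type*} [Group G] [TopologicalSpace G]
variable {D : Type*} [Group D] [Countable D]
variable {H : Type*} [Group H] [MetricSpace H] [IsTopologicalGroup H]
  [IsIsometricSMul H H] [IsIsometricSMul Hᵐᵒᵖ H]

/-- A Borel reduction of `E(G)` to `E(H)`, restricted to finitely many values at each place, can be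
replaced by one for which initial segments of the argument control initial segments of the value,
and final segments of the argument control final segments of the value up to a left translation. -/
theorem exists_stitched [SecondCountableTopology H] (ι : D →* G) {F : ℕ → Set D}
    (hF : ∀ j, (F j).Finite) (hF1 : ∀ j, (1 : D) ∈ F j) (φ : (ℕ → D) → ℕ → H)
    (hφm : ∀ _ : TopologicalSpace D, DiscreteTopology D → @Measurable _ _ (borel _) (borel _) φ)
    (hφ : ∀ x y : ℕ → D, (∃ a, Tendsto (fun n => ι (x n) * (ι (y n))⁻¹) atTop (𝓝 a)) ↔
      ∃ a, Tendsto (fun n => φ x n * (φ y n)⁻¹) atTop (𝓝 a)) :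
    ∃ (ψ : (ℕ → D) → ℕ → H) (M : ℕ → ℕ), StrictMono M ∧ ψ 1 = 1 ∧
      (∀ u v : ℕ → D, (∀ j, u j ∈ F j) → (∀ j, v j ∈ F j) →
        (∀ j, (∀ k ≥ j + 1, u k = v k) → ∀ l ≥ M (j + 1), ∀ l' ≥ M (j + 1),
          dist (ψ u l * (ψ v l)⁻¹) (ψ u l' * (ψ v l')⁻¹) ≤ (1 / 2) ^ (j + 1)) ∧
        (∀ j, (∀ k < j + 1, u k = v k) → ∀ l ≤ M (j + 1),
          dist (ψ u l) (ψ v l) ≤ (1 / 2) ^ (j + 1)) ∧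
        ((∃ a, Tendsto (quotProd (fun k => ι (u k)) (fun k => ι (v k))) atTop (𝓝 a)) ↔
          ∃ a, Tendsto (fun l => ψ u l * (ψ v l)⁻¹) atTop (𝓝 a))) := by
  let _ : TopologicalSpace D := ⊥
  have hD : DiscreteTopology D := ⟨rfl⟩
  obtain ⟨C, hCG, hCD, hφC, hCinv⟩ := exists_generic φ (hφm _ hD)
  obtain ⟨O, hO, rfl⟩ := hCG.eq_iInter_nat
  set C := ⋂ k, O k with hC
  -- A finite set containing all values of the multipliers `Γ u j` below.
  let E : ℕ → Set D := fun j => ⋃ k ∈ Set.Iic (j + 1),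
    {d | ∃ u : ℕ → D, (∀ j, u j ∈ F j) ∧ d = seqProd u k}
  have hE : ∀ j, (E j).Finite := fun j =>
    (Set.finite_Iic (j + 1)).biUnion fun k _ => finite_seqProd hF k
  have hconst : ∀ n, ∀ γ ∈ eventuallyConst (Set.univ : Set D) n,
      ∀ γ' ∈ eventuallyConst (Set.univ : Set D) n, ∀ v,
        ∃ a : H, Tendsto (fun l => φ (γ * v) l * (φ (γ' * v) l)⁻¹) atTop (𝓝 a) := by
    intro n γ hγ γ' hγ' v
    refine (hφ _ _).1 ⟨ι (γ n) * (ι (γ' n))⁻¹, tendsto_const_nhds.congr' ?_⟩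
    filter_upwards [eventually_ge_atTop n] with k hk
    simp [hγ.2 k hk, hγ'.2 k hk]
  obtain ⟨s, hs0, hs⟩ := exists_seq_of_step
    (fun j (p q : ℕ × ℕ × (ℕ → D)) => q.1 > p.1 ∧ q.2.1 > p.2.1 ∧ (∀ k < p.1, q.2.2 k = p.2.2 k) ∧
      (∀ γ ∈ eventuallyConst (E j) p.1, ∀ x : ℕ → D, (∀ k < q.1, x k = γ k * q.2.2 k) → x ∈ O j) ∧
      (∀ γ ∈ eventuallyConst (E j) p.1, ∀ γ' ∈ eventuallyConst (E j) p.1, ∀ v ∈ C,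
        (∀ k < q.1, v k = q.2.2 k) → ∀ l ≥ q.2.1, ∀ l' ≥ q.2.1,
          dist (φ (γ * v) l * (φ (γ' * v) l)⁻¹)
            (φ (γ * v) l' * (φ (γ' * v) l')⁻¹) ≤ (1 / 2) ^ (j + 1)) ∧
      (∀ γ ∈ eventuallyConst (E j) p.1, ∀ v ∈ C, ∀ v' ∈ C, (∀ k < q.1, v k = γ k * q.2.2 k) →
        (∀ k < q.1, v' k = γ k * q.2.2 k) → ∀ l ≤ q.2.1, dist (φ v l) (φ v' l) ≤ (1 / 2) ^ (j + 1)))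
    (fun j p => by
      obtain ⟨n', hn', m', hm', z', h⟩ := exists_stitch_step hCG hCD hφC hCinv hconst (hE j) (hO j)
        (Set.iInter_subset O j) (ε := (1 / 2) ^ (j + 1)) (by positivity) p.1 p.2.1 p.2.2
      exact ⟨(n', m', z'), hn', hm', h⟩) (0, 0, 1)
  obtain ⟨N, hN⟩ : ∃ N : ℕ → ℕ, ∀ j, N j = (s j).1 := ⟨_, fun _ => rfl⟩
  obtain ⟨M, hM⟩ : ∃ M : ℕ → ℕ, ∀ j, M j = (s j).2.1 := ⟨_, fun _ => rfl⟩
  obtain ⟨Z, hZ⟩ : ∃ Z : ℕ → ℕ → D, ∀ j, Z j = (s j).2.2 := ⟨_, fun _ => rfl⟩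
  simp only [← hN, ← hM, ← hZ] at hs
  have hN0 : N 0 = 0 := by rw [hN, hs0]
  have hNs : StrictMono N := strictMono_nat_of_lt_succ fun j => (hs j).1
  have hMs : StrictMono M := strictMono_nat_of_lt_succ fun j => (hs j).2.1
  have hZle : ∀ j i, j ≤ i → ∀ k < N j, Z i k = Z j k := by
    intro j i hji
    induction i, hji using Nat.le_induction with
    | base => exact fun _ _ => rfl
    | succ i hji ih =>
      intro k hk
      rw [(hs i).2.2.1 k (hk.trans_le (hNs.monotone hji)), ih k hk]
  obtain ⟨z, hz⟩ : ∃ z : ℕ → D, ∀ j, ∀ k < N j, z k = Z j k := by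
    refine ⟨fun k => Z (k + 1) k, fun j k hk => ?_⟩
    rcases le_total j (k + 1) with h | h
    · exact hZle _ _ h k hk
    · exact (hZle _ _ h k (Nat.lt_of_succ_le (hNs.id_le _))).symm
  -- The partial products of `u`, each held constant along one block. The right factor `z` brings `x
  -- u` into `C` and cancels in quotients.
  let x : (ℕ → D) → ℕ → D := fun u n => seqProd u (blockIndex N n + 1) * z n
  let Γ : (ℕ → D) → ℕ → ℕ → D := fun u j n => seqProd u (min (blockIndex N n + 1) (j + 1))
  have hblk : ∀ j, ∀ k < N (j + 1), blockIndex N k ≤ j := by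
    intro j k hk
    have h1 := (exists_block hNs (n := k) (by omega)).1
    exact Nat.lt_succ_iff.1 (hNs.lt_iff_lt.1 (h1.trans_lt hk))
  have hΓ : ∀ u : ℕ → D, (∀ j, u j ∈ F j) → ∀ j, Γ u j ∈ eventuallyConst (E j) (N j) := by
    intro u hu j
    refine ⟨fun k => Set.mem_biUnion (x := min (blockIndex N k + 1) (j + 1)) 
      (Set.mem_Iic.2 (min_le_right _ _)) ⟨u, hu, rfl⟩, fun k hk => ?_⟩
    have h1 : j ≤ blockIndex N k := le_blockIndex hNs hk
    have h2 : j ≤ blockIndex N (N j) := le_blockIndex hNs le_rfl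
    simp only [Γ]
    rw [min_eq_right (by omega), min_eq_right (by omega)]
  have hxΓ : ∀ u j, ∀ k < N (j + 1), x u k = Γ u j k * Z (j + 1) k := by
    intro u j k hk
    have := hblk j k hk
    simp only [x, Γ]
    rw [hz _ k hk, min_eq_left (by omega)]
  have hxC : ∀ u : ℕ → D, (∀ j, u j ∈ F j) → x u ∈ C := fun u hu =>
    Set.mem_iInter.2 fun j => (hs j).2.2.2.1 _ (hΓ u hu j) _ (hxΓ u j)
  -- The right factor normalizes the value at `1` and drops out of the quotients of two values.
  refine ⟨fun u l => φ (x u) l * (φ (x 1) l)⁻¹, M, hMs, ?_, fun u v hu hv => ⟨?_, ?_, ?_⟩⟩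
  · funext l
    simp
  · intro j huv l hl l' hl'
    -- With equal tails, `x u` and `x v` are eventually constant translates of the same point `x (w
    -- u)` of `C`.
    let w : (ℕ → D) → ℕ → D := fun u k => if k < j + 1 then 1 else u k
    have hw : w u = w v := by
      funext k
      by_cases hk : k < j + 1
      · simp only [w, if_pos hk]
      · simp only [w, if_neg hk, huv k (by omega)]
    have hxw : ∀ u, x u = Γ u j * x (w u) := by
      intro u
      funext n
      simp only [x, Γ, Pi.mul_apply]
      rw [seqProd_eq_mul u (j + 1), mul_assoc]
    have hwF : ∀ k, w u k ∈ F k := by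
      intro k
      by_cases hk : k < j + 1
      · simpa only [w, if_pos hk] using hF1 k
      · simpa only [w, if_neg hk] using hu k
    have h1 := (hs j).2.2.2.2.1 (Γ u j) (hΓ u hu j) (Γ v j) (hΓ v hv j) (x (w u)) (hxC _ hwF) ?_
      l hl l' hl'
    · rw [← hxw, hw, ← hxw] at h1
      simpa using h1
    · intro k hk
      have h2 := hblk j k hk
      simp only [x]
      rw [hz _ k hk, seqProd_eq_of_eq_one (Nat.zero_le _), seqProd_zero, one_mul]
      intro i _ hi
      exact if_pos (by omega)
  · intro j huv l hl
    rw [dist_mul_right]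
    refine (hs j).2.2.2.2.2 (Γ u j) (hΓ u hu j) _ (hxC u hu) _ (hxC v hv) (hxΓ u j) ?_ l hl
    intro k hk
    rw [hxΓ v j k hk]
    congr 1
    exact seqProd_congr fun i hi => (huv i (hi.trans_le (min_le_right _ _))).symm
  · have h1 : ∀ n, ι (x u n) * (ι (x v n))⁻¹ =
        quotProd (fun k => ι (u k)) (fun k => ι (v k)) (blockIndex N n + 1) := by
      intro n
      simp only [x, quotProd, map_mul, map_seqProd]
      group
    have h2 := hφ (x u) (x v)
    simp only [h1] at h2
    simp only [mul_inv_rev, inv_inv, mul_assoc, inv_mul_cancel_left]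
    rw [← h2]
    refine exists_congr fun a => ⟨fun h => ?_, fun h => ?_⟩
    · refine h.comp ((tendsto_add_atTop_nat 1).comp (tendsto_atTop.2 fun k => ?_))
      filter_upwards [eventually_ge_atTop (N k)] with n hn using le_blockIndex hNs hn
    · have h3 := h.comp hNs.tendsto_atTop
      rw [← tendsto_add_atTop_iff_nat 1]
      refine h3.congr fun j => ?_
      simp only [Function.comp_apply]
      rw [blockIndex_eq hNs le_rfl (hNs (Nat.lt_succ_self j))]

end Stitching

/-! ### Reductions that act block by block. -/

section BlockReduction

/-- The product of the first `j` final values of the blocks `τ k (u k)`. -/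
def blockProd {D H : Type*} [Monoid H] (τ : ℕ → D → ℕ → H) (M : ℕ → ℕ) (u : ℕ → D) : ℕ → H :=
  seqProd fun k => τ k (u k) (M (k + 1))

/-- A reduction of `E(G)`, restricted to sequences of increments in `∏ F j`, to `E(H)` which sends
a sequence of increments `u` to the concatenation of the blocks `τ j (u j)`. The `j`-th block is
indexed by `[M j, M (j + 1)]`. -/
structure BlockReduction {D G : Type*} [Group D] [Group G] [TopologicalSpace G] (ι : D →* G)
    (F : ℕ → Set D) (H : Type*) [Group H] [MetricSpace H] where
  /-- the blocks -/
  τ : ℕ → D → ℕ → H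
  /-- the places where the blocks meet -/
  M : ℕ → ℕ
  strictMono_M : StrictMono M
  τ_one : ∀ j l, τ j 1 l = 1
  reduces : ∀ u v : ℕ → D, (∀ j, u j ∈ F j) → (∀ j, v j ∈ F j) →
    ((∃ a, Tendsto (quotProd (fun k => ι (u k)) (fun k => ι (v k))) atTop (𝓝 a)) ↔
      ∃ a : H, ∀ ε > 0, ∃ J, ∀ j ≥ J, ∀ l ∈ Set.Icc (M j) (M (j + 1)),
        dist (blockProd τ M u j * τ j (u j) l * (blockProd τ M v j * τ j (v j) l)⁻¹) a < ε)

variable {G : Type*} [Group G] [TopologicalSpace G]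
variable {D : Type*} [Group D] [Countable D]
variable {H : Type*} [Group H] [MetricSpace H] [IsTopologicalGroup H]
  [IsIsometricSMul H H] [IsIsometricSMul Hᵐᵒᵖ H]

/-- Erasing earlier increments changes later values of `ψ` almost only by a constant left factor,
and erasing later increments barely changes earlier values. So on each block `ψ u` is, up to a left
factor, close to its value at a single increment. The errors are summable, so the left factors
converge to some `κ`, which does not affect convergence of quotients. -/
theorem nonempty_blockReduction [SecondCountableTopology H] [CompleteSpace H] (ι : D →* G)
    {F : ℕ → Set D} (hF : ∀ j, (F j).Finite) (hF1 : ∀ j, (1 : D) ∈ F j) (φ : (ℕ → D) → ℕ → H)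
    (hφm : ∀ _ : TopologicalSpace D, DiscreteTopology D → @Measurable _ _ (borel _) (borel _) φ)
    (hφ : ∀ x y : ℕ → D, (∃ a, Tendsto (fun n => ι (x n) * (ι (y n))⁻¹) atTop (𝓝 a)) ↔
      ∃ a, Tendsto (fun n => φ x n * (φ y n)⁻¹) atTop (𝓝 a)) :
    Nonempty (BlockReduction ι F H) := by
  classical
  obtain ⟨ψ, M, hM, hψ1, hψ⟩ := exists_stitched ι hF hF1 φ hφm hφ
  let τ : ℕ → D → ℕ → H := fun j g => ψ (Pi.mulSingle j g)
  let A : (ℕ → D) → ℕ → H := blockProd τ M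
  have hest : ∀ u : ℕ → D, (∀ j, u j ∈ F j) → ∀ j, ∀ l ∈ Set.Icc (M (j + 1)) (M (j + 2)),
      dist (ψ u l) (ψ u (M (j + 1)) * τ (j + 1) (u (j + 1)) l) ≤ 3 * (1 / 2) ^ (j + 1) := by
    intro u hu j l hl
    let w : ℕ → D := fun k => if k < j + 1 then 1 else u k
    have hw : ∀ k, w k ∈ F k := by
      intro k
      by_cases hk : k < j + 1
      · simpa only [w, if_pos hk] using hF1 k
      · simpa only [w, if_neg hk] using hu k
    have hs : ∀ k, (Pi.mulSingle (j + 1) (u (j + 1)) : ℕ → D) k ∈ F k := by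
      intro k
      rcases eq_or_ne k (j + 1) with rfl | hk
      · simpa using hu _
      · simpa [hk] using hF1 k
    have h1 := (hψ u w hu hw).1 j (fun k hk => (if_neg (by omega)).symm) l hl.1 _ le_rfl
    have h2 := (hψ w 1 hw fun k => hF1 k).2.1 j (fun k hk => if_pos hk) _ le_rfl
    have h3 := (hψ w _ hw hs).2.1 (j + 1) (fun k hk => by
      rcases eq_or_ne k (j + 1) with rfl | hk'
      · simp only [w, Pi.mulSingle_eq_same, if_neg (lt_irrefl _)]
      · rw [Pi.mulSingle_eq_of_ne hk']
        exact if_pos (by omega)) l hl.2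
    have h4 : ((1 : ℝ) / 2) ^ (j + 1 + 1) ≤ (1 / 2) ^ (j + 1) :=
      pow_le_pow_of_le_one (by norm_num) (by norm_num) (Nat.le_succ _)
    set a := ψ u (M (j + 1))
    have e1 : dist (ψ u l) (a * (ψ w (M (j + 1)))⁻¹ * ψ w l) ≤ (1 / 2) ^ (j + 1) := by
      rwa [← dist_mul_right _ _ (ψ w l)⁻¹, mul_inv_cancel_right]
    have e2 : dist (a * (ψ w (M (j + 1)))⁻¹ * ψ w l) (a * ψ w l) ≤ (1 / 2) ^ (j + 1) := by
      rw [dist_mul_right, dist_mul_left_self, ← inv_one, dist_inv_inv]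
      simpa [hψ1] using h2
    have e3 : dist (a * ψ w l) (a * τ (j + 1) (u (j + 1)) l) ≤ (1 / 2) ^ (j + 1) := by
      rw [dist_mul_left]
      exact h3.trans h4
    have := dist_triangle4 (ψ u l) (a * (ψ w (M (j + 1)))⁻¹ * ψ w l) (a * ψ w l)
      (a * τ (j + 1) (u (j + 1)) l)
    linarith
  have hlim : ∀ u : ℕ → D, (∀ j, u j ∈ F j) → ∃ κ : H, ∀ ε > 0, ∃ J, ∀ j ≥ J,
      ∀ l ∈ Set.Icc (M j) (M (j + 1)), dist (ψ u l) (κ * (A u j * τ j (u j) l)) < ε := by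
    intro u hu
    have hc : CauchySeq fun j => ψ u (M (j + 1)) * (A u (j + 1))⁻¹ := by
      refine cauchySeq_of_le_geometric (1 / 2) (3 * (1 / 2)) (by norm_num) fun j => ?_
      have h1 := hest u hu j (M (j + 2)) ⟨(hM (Nat.lt_succ_self _)).le, le_rfl⟩
      rw [dist_comm] at h1
      have h2 : A u (j + 2) = A u (j + 1) * τ (j + 1) (u (j + 1)) (M (j + 2)) := rfl
      rw [h2, ← dist_mul_right _ _ (A u (j + 1) * τ (j + 1) (u (j + 1)) (M (j + 2)))]
      rw [inv_mul_cancel_right, ← mul_assoc, inv_mul_cancel_right]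
      refine h1.trans_eq ?_
      ring
    obtain ⟨κ, hκ⟩ := cauchySeq_tendsto_of_complete hc
    refine ⟨κ, fun ε hε => ?_⟩
    have h0 : Tendsto (fun j : ℕ => 3 * ((1 : ℝ) / 2) ^ (j + 1)) atTop (𝓝 0) := by
      have := (tendsto_pow_atTop_nhds_zero_of_lt_one (r := (1 : ℝ) / 2) (by norm_num)
        (by norm_num)).comp (tendsto_add_atTop_nat 1)
      simpa using this.const_mul 3
    have h3 := (Metric.tendsto_nhds.1 hκ (ε / 2) (by positivity)).and
      (h0.eventually (gt_mem_nhds (show (0 : ℝ) < ε / 2 by positivity)))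
    obtain ⟨J, hJ⟩ := eventually_atTop.1 h3
    refine ⟨J + 1, fun j hj l hl => ?_⟩
    obtain ⟨i, rfl⟩ : ∃ i, j = i + 1 := ⟨j - 1, by omega⟩
    obtain ⟨h4, h5⟩ := hJ i (by omega)
    have h6 := hest u hu i l hl
    have h7 := dist_triangle (ψ u l) (ψ u (M (i + 1)) * τ (i + 1) (u (i + 1)) l)
      (κ * (A u (i + 1) * τ (i + 1) (u (i + 1)) l))
    rw [← mul_assoc, dist_mul_right (ψ u (M (i + 1)))] at h7
    rw [← dist_mul_right _ _ (A u (i + 1)), inv_mul_cancel_right] at h4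
    rw [← mul_assoc]
    linarith
  refine ⟨⟨τ, M, hM, fun j l => ?_, fun u v hu hv => ?_⟩⟩
  · simp [τ, hψ1]
  rw [(hψ u v hu hv).2.2]
  obtain ⟨κ, hκ⟩ := hlim u hu
  obtain ⟨κ', hκ'⟩ := hlim v hv
  have key : ∀ ε > 0, ∃ J, ∀ j ≥ J, ∀ l ∈ Set.Icc (M j) (M (j + 1)),
      dist (ψ u l * (ψ v l)⁻¹) (κ * (A u j * τ j (u j) l * (A v j * τ j (v j) l)⁻¹) * κ'⁻¹)
        < ε := by
    intro ε hε
    obtain ⟨J, hJ⟩ := hκ (ε / 2) (by positivity)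
    obtain ⟨J', hJ'⟩ := hκ' (ε / 2) (by positivity)
    refine ⟨max J J', fun j hj l hl => ?_⟩
    have h1 := hJ j ((le_max_left _ _).trans hj) l hl
    have h2 := hJ' j ((le_max_right _ _).trans hj) l hl
    have h3 := dist_mul_inv_mul_inv_le (ψ u l) (ψ v l) (κ * (A u j * τ j (u j) l))
      (κ' * (A v j * τ j (v j) l))
    have h4 : κ * (A u j * τ j (u j) l) * (κ' * (A v j * τ j (v j) l))⁻¹ =
      κ * (A u j * τ j (u j) l * (A v j * τ j (v j) l)⁻¹) * κ'⁻¹ := by group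
    rw [h4] at h3
    linarith
  constructor
  · rintro ⟨a, ha⟩
    refine ⟨κ⁻¹ * a * κ', fun ε hε => ?_⟩
    obtain ⟨J, hJ⟩ := key (ε / 2) (by positivity)
    obtain ⟨L, hL⟩ := Metric.tendsto_atTop.1 ha (ε / 2) (by positivity)
    refine ⟨max J L, fun j hj l hl => ?_⟩
    have h1 := hJ j ((le_max_left _ _).trans hj) l hl
    have h2 := hL l (((le_max_right _ _).trans hj).trans ((hM.id_le j).trans hl.1))
    have h3 := dist_triangle_left
      (κ * (A u j * τ j (u j) l * (A v j * τ j (v j) l)⁻¹) * κ'⁻¹) a (ψ u l * (ψ v l)⁻¹)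
    rw [← dist_mul_left κ, ← dist_mul_right _ _ κ'⁻¹]
    have h4 : κ * (κ⁻¹ * a * κ') * κ'⁻¹ = a := by group
    rw [h4]
    exact h3.trans_lt (by linarith)
  · rintro ⟨a, ha⟩
    refine ⟨κ * a * κ'⁻¹, Metric.tendsto_atTop.2 fun ε hε => ?_⟩
    obtain ⟨J, hJ⟩ := key (ε / 2) (by positivity)
    obtain ⟨J', hJ'⟩ := ha (ε / 2) (by positivity)
    refine ⟨M (max J J'), fun l hl => ?_⟩
    have hj := le_blockIndex hM hl
    obtain ⟨hb, hb'⟩ := exists_block hM ((hM.monotone (Nat.zero_le _)).trans hl)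
    have h1 := hJ _ ((le_max_left _ _).trans hj) l ⟨hb, hb'.le⟩
    have h2 := hJ' _ ((le_max_right _ _).trans hj) l ⟨hb, hb'.le⟩
    rw [← dist_mul_left κ, ← dist_mul_right _ _ κ'⁻¹] at h2
    refine (dist_triangle _ _ _).trans_lt (add_lt_add h1 h2) |>.trans_eq (by ring)

end BlockReduction

/-! ### Estimates local to a block. -/

section Blocks

theorem exists_tendsto_of_blocks {X : Type*} [MetricSpace X] [CompleteSpace X] {x : ℕ → X}
    {N : ℕ → ℕ} (hN : StrictMono N)
    (h : ∀ k n, N k ≤ n → n ≤ N (k + 1) → dist (x n) (x (N k)) ≤ (1 / 2) ^ k) :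
    ∃ a, Tendsto x atTop (𝓝 a) := by
  have h1 : ∀ k, dist (x (N k)) (x (N (k + 1))) ≤ 1 * (1 / 2) ^ k := fun k => by
    rw [one_mul, dist_comm]
    exact h k _ (hN (Nat.lt_succ_self k)).le le_rfl
  obtain ⟨a, ha⟩ := cauchySeq_tendsto_of_complete
    (cauchySeq_of_le_geometric (1 / 2) 1 (by norm_num) h1)
  refine ⟨a, Metric.tendsto_atTop.2 fun ε hε => ?_⟩
  have h0 : Tendsto (fun k : ℕ => ((1 : ℝ) / 2) ^ k) atTop (𝓝 0) :=
    tendsto_pow_atTop_nhds_zero_of_lt_one (by norm_num) (by norm_num)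
  obtain ⟨k, hk⟩ := eventually_atTop.1 ((Metric.tendsto_nhds.1 ha (ε / 2) (by positivity)).and
    (h0.eventually (gt_mem_nhds (show (0 : ℝ) < ε / 2 by positivity))))
  refine ⟨N k, fun n hn => ?_⟩
  obtain ⟨hb, hb'⟩ := exists_block hN ((hN.monotone (Nat.zero_le _)).trans hn)
  have h2 := hk _ (le_blockIndex hN hn)
  have h3 := h _ n hb hb'.le
  have h4 := dist_triangle (x n) (x (N (blockIndex N n))) a
  linarith

theorem seqProd_eq_prod_range {M : Type*} [Monoid M] (u : ℕ → M) (n : ℕ) :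
    seqProd u n = ((List.range n).map u).prod := by
  induction n with
  | zero => rfl
  | succ n ih => simp [seqProd_succ, ih, List.range_succ]

theorem List.prod_map_ite_one {α M : Type*} [Monoid M] (p : α → Prop) [DecidablePred p] (w : α → M)
    (L : List α) :
    (L.map fun k => if p k then w k else 1).prod = ((L.filter p).map w).prod := by
  induction L with
  | nil => rfl
  | cons a L ih =>
    by_cases h : p a
    · simp [h, ih]
    · simp [h, ih]

theorem seqProd_ite_mem {M : Type*} [Monoid M] (w : ℕ → M) {l : List ℕ} (hl : l.Pairwise (· < ·))
    {n : ℕ} (hn : ∀ k ∈ l, k < n) :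
    seqProd (fun k => if k ∈ l then w k else 1) n = (l.map w).prod := by
  rw [seqProd_eq_prod_range, List.prod_map_ite_one]
  congr 2
  have h1 : ((List.range n).filter (· ∈ l)).Pairwise (· < ·) := List.pairwise_lt_range.filter _
  refine List.Perm.eq_of_pairwise (fun a b _ _ hab hba => absurd hab (lt_asymm hba)) h1 hl ?_
  refine (List.perm_ext_iff_of_nodup (h1.imp ne_of_lt) (hl.imp ne_of_lt)).2 fun k => ?_
  simp only [List.mem_filter, List.mem_range, decide_eq_true_eq]
  exact ⟨fun h => h.2, fun h => ⟨hn k h, h⟩⟩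

/-- By two-sided invariance earlier factors cancel. This locality lets conditions on blocks be glued
by `exists_glued`. -/
theorem dist_quotProd_congr {G : Type*} [Group G] [MetricSpace G] [IsIsometricSMul G G]
    [IsIsometricSMul Gᵐᵒᵖ G] {u v u' v' : ℕ → G} {N n : ℕ} (hn : N ≤ n)
    (hu : ∀ k, N ≤ k → k < n → u k = u' k) (hv : ∀ k, N ≤ k → k < n → v k = v' k) :
    dist (quotProd u v n) (quotProd u v N) = dist (quotProd u' v' n) (quotProd u' v' N) := by
  simp only [quotProd, dist_mul_inv_mul_inv]
  rw [seqProd_inv_mul_congr hn hu, seqProd_inv_mul_congr hn hv]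

end Blocks

/-! ### Uniform continuity, and the effect of the strong NSS property. -/

namespace BlockReduction

variable {G : Type*} [Group G] [MetricSpace G] [IsIsometricSMul G G] [IsIsometricSMul Gᵐᵒᵖ G]
variable {D : Type*} [Group D] {ι : D →* G} {F : ℕ → Set D}
variable {H : Type*} [Group H] [MetricSpace H] [IsIsometricSMul H H] [IsIsometricSMul Hᵐᵒᵖ H]

/-- The value at the place `l` of the `j`-th block. -/
def val (R : BlockReduction ι F H) (u : ℕ → D) (j l : ℕ) : H :=
  blockProd R.τ R.M u j * R.τ j (u j) l

/-- The product of the first `j` increments. -/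
def prod (R : BlockReduction ι F H) (u : ℕ → D) (j : ℕ) : H := blockProd R.τ R.M u j

/-- The increment of the `j`-th block. -/
def σ (R : BlockReduction ι F H) (j : ℕ) (g : D) : H := R.τ j g (R.M (j + 1))

theorem σ_one (R : BlockReduction ι F H) (j : ℕ) : R.σ j 1 = 1 := R.τ_one _ _

theorem prod_eq_seqProd (R : BlockReduction ι F H) (u : ℕ → D) (j : ℕ) :
    R.prod u j = seqProd (fun k => R.σ k (u k)) j := rfl

theorem prod_succ (R : BlockReduction ι F H) (u : ℕ → D) (j : ℕ) :
    R.prod u (j + 1) = R.prod u j * R.σ j (u j) := rfl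

theorem val_last (R : BlockReduction ι F H) (u : ℕ → D) (j : ℕ) :
    R.val u j (R.M (j + 1)) = R.prod u (j + 1) := rfl

theorem last_mem (R : BlockReduction ι F H) (j : ℕ) :
    R.M (j + 1) ∈ Set.Icc (R.M j) (R.M (j + 1)) :=
  ⟨(R.strictMono_M (Nat.lt_succ_self j)).le, le_rfl⟩

theorem inv_mul_prod_congr (R : BlockReduction ι F H) {u u' : ℕ → D} {N j : ℕ} (hj : N ≤ j)
    (hu : ∀ k, N ≤ k → k < j → u k = u' k) :
    (R.prod u N)⁻¹ * R.prod u j = (R.prod u' N)⁻¹ * R.prod u' j := by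
  refine seqProd_inv_mul_congr hj fun k hk hk' => ?_
  rw [hu k hk hk']

theorem inv_mul_val_congr (R : BlockReduction ι F H) {u u' : ℕ → D} {N j : ℕ} (hj : N ≤ j)
    (hu : ∀ k, N ≤ k → k < j + 1 → u k = u' k) (l : ℕ) :
    (R.prod u N)⁻¹ * R.val u j l = (R.prod u' N)⁻¹ * R.val u' j l := by
  have h := R.inv_mul_prod_congr hj fun k hk hk' => hu k hk (by omega)
  simp only [val, prod] at h ⊢
  rw [← mul_assoc, ← mul_assoc, h, hu j hj (Nat.lt_succ_self j)]

theorem dist_val_congr (R : BlockReduction ι F H) {u u' v v' : ℕ → D} {N j : ℕ} (hj : N ≤ j)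
    (hu : ∀ k, N ≤ k → k < j + 1 → u k = u' k) (hv : ∀ k, N ≤ k → k < j + 1 → v k = v' k) (l : ℕ) :
    dist (R.val u j l * (R.val v j l)⁻¹) (R.prod u N * (R.prod v N)⁻¹) =
      dist (R.val u' j l * (R.val v' j l)⁻¹) (R.prod u' N * (R.prod v' N)⁻¹) := by
  rw [dist_mul_inv_mul_inv, dist_mul_inv_mul_inv, R.inv_mul_val_congr hj hu,
    R.inv_mul_val_congr hj hv]

/-- A block reduction is uniformly continuous: small differences go to small differences. -/
theorem exists_forall_dist_val_le [CompleteSpace G] (R : BlockReduction ι F H) {ε : ℝ}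
    (hε : 0 < ε) :
    ∃ N, ∃ δ > 0, ∀ u v : ℕ → D, (∀ j, u j ∈ F j) → (∀ j, v j ∈ F j) → ∀ j ≥ N,
      (∀ n, N ≤ n → n ≤ j + 1 → dist (quotProd (fun k => ι (u k)) (fun k => ι (v k)) n)
        (quotProd (fun k => ι (u k)) (fun k => ι (v k)) N) < δ) →
      ∀ l ∈ Set.Icc (R.M j) (R.M (j + 1)),
        dist (R.val u j l * (R.val v j l)⁻¹) (R.prod u N * (R.prod v N)⁻¹) ≤ ε := by
  by_contra! h
  -- Counterexamples for `δ = (1 / 2) ^ k` are glued: the quotients in `G` converge, while those in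
  -- `H` keep moving by more than `ε`.
  obtain ⟨N, hN, hN0, p, -, hp⟩ := exists_glued ((1, 1) : D × D)
    (fun k N M p => (∀ i, N ≤ i → i < M → (p i).1 ∈ F i ∧ (p i).2 ∈ F i) ∧
      (∀ n, N ≤ n → n ≤ M → dist (quotProd (fun k => ι (p k).1) (fun k => ι (p k).2) n)
        (quotProd (fun k => ι (p k).1) (fun k => ι (p k).2) N) < (1 / 2) ^ k) ∧
      ∃ j, N ≤ j ∧ M = j + 1 ∧ ∃ l ∈ Set.Icc (R.M j) (R.M (j + 1)),
        ε < dist (R.val (fun i => (p i).1) j l * (R.val (fun i => (p i).2) j l)⁻¹)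
          (R.prod (fun i => (p i).1) N * (R.prod (fun i => (p i).2) N)⁻¹))
    (by
      rintro k N M p q hpq ⟨h1, h2, j, hj, rfl, l, hl, h3⟩
      refine ⟨fun i hi hi' => hpq i hi hi' ▸ h1 i hi hi', fun n hn hn' => ?_, j, hj, rfl, l, hl, ?_⟩
      · rw [← dist_quotProd_congr (u := fun k => ι (p k).1) (v := fun k => ι (p k).2) hn]
        · exact h2 n hn hn'
        · intro i hi hi'
          rw [hpq i hi (by omega)]
        · intro i hi hi'
          rw [hpq i hi (by omega)]
      · rw [← R.dist_val_congr (u := fun i => (p i).1) (v := fun i => (p i).2) hj]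
        · exact h3
        · intro i hi hi'
          rw [hpq i hi (by omega)]
        · intro i hi hi'
          rw [hpq i hi (by omega)])
    (by
      intro k N
      obtain ⟨u, v, hu, hv, j, hj, h1, l, hl, h2⟩ := h N ((1 / 2) ^ k) (by positivity)
      exact ⟨j + 1, by omega, fun i => (u i, v i), fun i _ _ => ⟨hu i, hv i⟩, h1, j, hj, rfl, l,
        hl, h2⟩) 0
  have hF : ∀ n, (p n).1 ∈ F n ∧ (p n).2 ∈ F n := fun n => by
    obtain ⟨hb, hb'⟩ := exists_block hN (n := n) (by omega)
    exact (hp _).1 n hb hb'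
  obtain ⟨a, ha⟩ := (R.reduces (fun i => (p i).1) (fun i => (p i).2) (fun n => (hF n).1)
    fun n => (hF n).2).1 (exists_tendsto_of_blocks hN fun k n hn hn' => ((hp k).2.1 n hn hn').le)
  obtain ⟨J, hJ⟩ := ha (ε / 2) (by positivity)
  obtain ⟨-, -, j, hj, hj', l, hl, h1⟩ := hp (J + 1)
  have hJN := hN.id_le (J + 1)
  simp only [id] at hJN
  have h2 := hJ j (by omega) l hl
  obtain ⟨i, hi⟩ : ∃ i, N (J + 1) = i + 1 := ⟨N (J + 1) - 1, by omega⟩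
  -- The value at the start of a glued block is the last value at the place `i` just before it, so
  -- it too is within `ε / 2` of the limit.
  have h3 := hJ i (by omega) _ (R.last_mem i)
  have h4 := dist_triangle_right (R.val (fun i => (p i).1) j l * (R.val (fun i => (p i).2) j l)⁻¹)
    (R.prod (fun i => (p i).1) (N (J + 1)) * (R.prod (fun i => (p i).2) (N (J + 1)))⁻¹) a
  rw [hi] at h1 h4
  simp only [← val_last] at h1 h4
  simp only [val] at h1 h4
  linarith

variable {K : Type*} [Group K] [MetricSpace K] [IsIsometricSMul K K] [IsIsometricSMul Kᵐᵒᵖ K]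

/-- In a strongly NSS quotient, bounded differences that vanish at the end go to differences that
are small at the end. -/
theorem exists_forall_dist_prod_lt [CompleteSpace G] (R : BlockReduction ι F H)
    (hF1 : ∀ j, (1 : D) ∈ F j) (π : H →* K) (hπ : Continuous π) (hK : IsStronglyNSS K) :
    ∃ δ > 0, ∀ η > 0, ∃ N, ∀ u v : ℕ → D, (∀ j, u j ∈ F j) → (∀ j, v j ∈ F j) → ∀ m ≥ N,
      (∀ n, N ≤ n → n ≤ m → dist (quotProd (fun k => ι (u k)) (fun k => ι (v k)) n)
        (quotProd (fun k => ι (u k)) (fun k => ι (v k)) N) < δ) →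
      quotProd (fun k => ι (u k)) (fun k => ι (v k)) m =
        quotProd (fun k => ι (u k)) (fun k => ι (v k)) N →
      dist (π (R.prod u m * (R.prod v m)⁻¹)) (π (R.prod u N * (R.prod v N)⁻¹)) < η := by
  obtain ⟨V, hVo, hV1, hV⟩ := hK
  obtain ⟨ε, hε, hεV⟩ : ∃ ε > 0, ∀ h : H, dist h 1 ≤ ε → π h ∈ V := by
    have h1 : π ⁻¹' V ∈ 𝓝 (1 : H) := hπ.continuousAt.preimage_mem_nhds
      (hVo.mem_nhds (by simpa using hV1))
    obtain ⟨ε, hε, h⟩ := Metric.nhds_basis_closedBall.mem_iff.1 h1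
    exact ⟨ε, hε, fun x hx => h hx⟩
  -- `δ` depends on `V` only, so one `δ` serves every `η`.
  obtain ⟨N₀, δ, hδ, hA⟩ := R.exists_forall_dist_val_le hε
  refine ⟨δ, hδ, fun η hη => ?_⟩
  by_contra! h
  -- The default value makes both sequences trivial before `N₀`, so every mixture of them starts
  -- with quotient `1`.
  obtain ⟨N, hN, hN0, p, hp0, hp⟩ := exists_glued ((1, 1) : D × D)
    (fun k N M p => (∀ i, N ≤ i → i < M → (p i).1 ∈ F i ∧ (p i).2 ∈ F i) ∧
      (∀ n, N ≤ n → n ≤ M → dist (quotProd (fun k => ι (p k).1) (fun k => ι (p k).2) n)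
        (quotProd (fun k => ι (p k).1) (fun k => ι (p k).2) N) < δ) ∧
      dist (quotProd (fun k => ι (p k).1) (fun k => ι (p k).2) M)
        (quotProd (fun k => ι (p k).1) (fun k => ι (p k).2) N) = 0 ∧ N ≤ M ∧
      η ≤ dist (π ((R.prod (fun i => (p i).1) N)⁻¹ * R.prod (fun i => (p i).1) M))
        (π ((R.prod (fun i => (p i).2) N)⁻¹ * R.prod (fun i => (p i).2) M)))
    (by
      rintro k N M p q hpq ⟨h1, h2, h3, hNM, h4⟩
      have hpq1 : ∀ i, N ≤ i → i < M → (p i).1 = (q i).1 := fun i hi hi' => by rw [hpq i hi hi']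
      have hpq2 : ∀ i, N ≤ i → i < M → (p i).2 = (q i).2 := fun i hi hi' => by rw [hpq i hi hi']
      have hd : ∀ n, N ≤ n → n ≤ M → dist (quotProd (fun k => ι (p k).1) (fun k => ι (p k).2) n)
        (quotProd (fun k => ι (p k).1) (fun k => ι (p k).2) N) =
        dist (quotProd (fun k => ι (q k).1) (fun k => ι (q k).2) n)
        (quotProd (fun k => ι (q k).1) (fun k => ι (q k).2) N) := fun n hn hn' =>
        dist_quotProd_congr hn (fun i hi hi' => by rw [hpq1 i hi (by omega)])
          fun i hi hi' => by rw [hpq2 i hi (by omega)]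
      refine ⟨fun i hi hi' => hpq i hi hi' ▸ h1 i hi hi', fun n hn hn' => ?_, ?_, hNM, ?_⟩
      · rw [← hd n hn hn']
        exact h2 n hn hn'
      · rw [← hd M hNM le_rfl, h3]
      · rwa [← R.inv_mul_prod_congr hNM hpq1, ← R.inv_mul_prod_congr hNM hpq2])
    (by
      intro k N
      obtain ⟨u, v, hu, hv, m, hm, h1, h2, h3⟩ := h N
      have hne : m ≠ N := by
        rintro rfl
        rw [dist_self] at h3
        linarith
      refine ⟨m, by omega, fun i => (u i, v i), fun i _ _ => ⟨hu i, hv i⟩, h1, ?_, hm, ?_⟩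
      · rw [h2, dist_self]
      · simp only [map_mul, map_inv, dist_mul_inv_mul_inv] at h3 ⊢
        exact h3) N₀
  obtain ⟨a, ha⟩ : ∃ a : ℕ → D, ∀ i, a i = (p i).1 := ⟨_, fun _ => rfl⟩
  obtain ⟨b, hb⟩ : ∃ b : ℕ → D, ∀ i, b i = (p i).2 := ⟨_, fun _ => rfl⟩
  simp only [← ha, ← hb] at hp
  have hab : ∀ n < N₀, a n = 1 ∧ b n = 1 := fun n hn => by
    rw [ha, hb, hp0 n hn]
    exact ⟨rfl, rfl⟩
  have hF : ∀ n, a n ∈ F n ∧ b n ∈ F n := fun n => by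
    by_cases hn : n < N₀
    · rw [(hab n hn).1, (hab n hn).2]
      exact ⟨hF1 n, hF1 n⟩
    · obtain ⟨h1, h2⟩ := exists_block hN (n := n) (by omega)
      exact (hp _).1 n h1 h2
  -- The discrepancy of the `k`-th block, conjugated so that the output quotient of a mixture over
  -- `b` telescopes to an ordered product of these elements.
  let w : ℕ → H := fun k => R.prod b (N k) * ((R.prod a (N k))⁻¹ * R.prod a (N (k + 1))) *
    ((R.prod b (N k))⁻¹ * R.prod b (N (k + 1)))⁻¹ * (R.prod b (N k))⁻¹
  have hNle : ∀ k, N k ≤ N (k + 1) := fun k => (hN (Nat.lt_succ_self k)).le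
  have key : ∀ l : List ℕ, l.Pairwise (· < ·) → (l.map fun k => π (w k)).prod ∈ V := by
    intro l hl
    -- The quotient of `u` over `b` in `G` returns at the end of each block, so it stays within `δ`
    -- throughout, however many blocks are switched.
    let u : ℕ → D := fun n => if blockIndex N n ∈ l then a n else b n
    have hu : ∀ n, u n ∈ F n := fun n => by
      by_cases hn : blockIndex N n ∈ l
      · simpa only [u, if_pos hn] using (hF n).1
      · simpa only [u, if_neg hn] using (hF n).2
    have hu0 : ∀ n < N₀, u n = b n := fun n hn => by
      by_cases hn' : blockIndex N n ∈ l
      · simp only [u, if_pos hn', (hab n hn).1, (hab n hn).2]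
      · simp only [u, if_neg hn']
    have hu1 : ∀ k ∈ l, ∀ n, N k ≤ n → n < N (k + 1) → u n = a n := fun k hk n hn hn' => by
      simp only [u, blockIndex_eq hN hn hn', if_pos hk]
    have hu2 : ∀ k ∉ l, ∀ n, N k ≤ n → n < N (k + 1) → u n = b n := fun k hk n hn hn' => by
      simp only [u, blockIndex_eq hN hn hn', if_neg hk]
    have hprod : ∀ k, R.prod u (N k) * (R.prod b (N k))⁻¹ =
        seqProd (fun k => if k ∈ l then w k else 1) k := by
      intro k
      induction k with
      | zero =>
        rw [hN0, seqProd_zero, mul_inv_eq_one]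
        exact seqProd_congr fun n hn => by rw [hu0 n hn]
      | succ k ih =>
        rw [seqProd_succ, ← ih]
        by_cases hk : k ∈ l
        · have h1 := R.inv_mul_prod_congr (hNle k) (hu1 k hk)
          rw [if_pos hk]
          simp only [w]
          rw [← h1]
          group
        · have h1 := R.inv_mul_prod_congr (hNle k) (hu2 k hk)
          rw [if_neg hk, mul_one, ← mul_inv_cancel_left (R.prod u (N k)) (R.prod u (N (k + 1))), h1]
          group
    have hblock : ∀ k n, N k ≤ n → n ≤ N (k + 1) →
        dist (quotProd (fun k => ι (u k)) (fun k => ι (b k)) n)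
          (quotProd (fun k => ι (u k)) (fun k => ι (b k)) (N k)) < δ ∧
        (n = N (k + 1) → quotProd (fun k => ι (u k)) (fun k => ι (b k)) n =
          quotProd (fun k => ι (u k)) (fun k => ι (b k)) (N k)) := by
      intro k n hn hn'
      by_cases hk : k ∈ l
      · have h1 := dist_quotProd_congr (u := fun k => ι (u k)) (u' := fun k => ι (a k))
          (v := fun k => ι (b k)) (v' := fun k => ι (b k)) hn
          (fun i hi hi' => by rw [hu1 k hk i hi (by omega)]) fun _ _ _ => rfl
        refine ⟨h1 ▸ (hp k).2.1 n hn hn', ?_⟩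
        rintro rfl
        exact dist_eq_zero.1 (h1.trans (hp k).2.2.1)
      · have h1 := dist_quotProd_congr (u := fun k => ι (u k)) (u' := fun k => ι (b k))
          (v := fun k => ι (b k)) (v' := fun k => ι (b k)) hn
          (fun i hi hi' => by rw [hu2 k hk i hi (by omega)]) fun _ _ _ => rfl
        simp only [quotProd, mul_inv_cancel, dist_self] at h1
        exact ⟨h1 ▸ hδ, fun _ => dist_eq_zero.1 h1⟩
    have hquot : ∀ k, quotProd (fun k => ι (u k)) (fun k => ι (b k)) (N k) =
        quotProd (fun k => ι (u k)) (fun k => ι (b k)) N₀ := by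
      intro k
      induction k with
      | zero => rw [hN0]
      | succ k ih => rw [(hblock k _ (hNle k) le_rfl).2 rfl, ih]
    obtain ⟨m, hm⟩ : ∃ m, ∀ k ∈ l, k < m + 1 := by
      obtain ⟨m, hm⟩ := l.toFinset.bddAbove
      exact ⟨m, fun k hk => Nat.lt_succ_of_le (hm (by simpa using hk))⟩
    have hm0 : N 0 < N (m + 1) := hN (Nat.succ_pos m)
    obtain ⟨j, hj⟩ : ∃ j, N (m + 1) = j + 1 := ⟨N (m + 1) - 1, by omega⟩
    have h1 := hA u b hu (fun n => (hF n).2) j (by omega) (fun n hn _ => by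
      obtain ⟨h1, h2⟩ := exists_block hN (n := n) (by omega)
      rw [← hquot (blockIndex N n)]
      exact (hblock _ n h1 h2.le).1) _ (R.last_mem j)
    have h0 : R.prod u N₀ * (R.prod b N₀)⁻¹ = 1 := by
      rw [← hN0, hprod 0, seqProd_zero]
    rw [val_last, val_last, ← hj, hprod, h0, seqProd_ite_mem w hl hm] at h1
    have h2 := hεV _ h1
    rwa [map_list_prod, List.map_map] at h2
  have hlim : Tendsto (fun k => π (w k)) atTop (𝓝 1) := by
    by_contra hlim
    obtain ⟨l, -, hl, hl'⟩ := hV _ hlim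
    exact hl' (key l hl)
  obtain ⟨k, hk⟩ := (Metric.tendsto_nhds.1 hlim η hη).exists
  have h1 := (hp k).2.2.2.2
  have h2 : dist (π (w k)) 1 =
      dist (π ((R.prod a (N k))⁻¹ * R.prod a (N (k + 1))))
        (π ((R.prod b (N k))⁻¹ * R.prod b (N (k + 1)))) := by
    -- Invariance of the metric removes the conjugation, so the discrepancies stay at distance at
    -- least `η` from `1`.
    have h3 : ∀ x y z : H, π (x * y * z⁻¹ * x⁻¹) = π x * (π y * (π z)⁻¹) * (π x)⁻¹ := by
      intro x y z
      simp [mul_assoc]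
    simp only [w]
    rw [h3, dist_mul_inv_one, dist_mul_left_self, dist_mul_inv_one]
  linarith

end BlockReduction

/-! ### Isolated increments and generation by small elements. -/

section Pulses

theorem seqProd_of_eq_one_of_ne {M : Type*} [Monoid M] {c : ℕ → M} {p q : ℕ} (hpq : p < q)
    (hc : ∀ k, k ≠ p → k ≠ q → c k = 1) :
    (∀ n ≤ p, seqProd c n = 1) ∧ (∀ n, p < n → n ≤ q → seqProd c n = c p) ∧
      seqProd c (q + 1) = c p * c q := by
  have h1 : ∀ n ≤ p, seqProd c n = 1 := fun n hn =>
    seqProd_eq_of_eq_one (Nat.zero_le n) fun k _ hk => hc k (by omega) (by omega)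
  have h2 : ∀ n, p < n → n ≤ q → seqProd c n = c p := by
    intro n hn hn'
    rw [seqProd_eq_of_eq_one (Nat.succ_le_of_lt hn) fun k hk hk' => hc k (by omega) (by omega),
      seqProd_succ, h1 p le_rfl, one_mul]
  exact ⟨h1, h2, by rw [seqProd_succ, h2 q hpq le_rfl]⟩

/-- In a connected group every element of a dense subgroup is a product of small elements of the
subgroup. -/
theorem mem_of_forall_mul_mem {G D : Type*} [Group G] [MetricSpace G] [IsIsometricSMul G G]
    [PreconnectedSpace G] [Group D] {ι : D →* G} (hι : DenseRange ι) {S : Set D} (h1 : (1 : D) ∈ S)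
    {δ : ℝ} (hδ : 0 < δ) (hS : ∀ g ∈ S, ∀ h, dist (ι h) 1 < δ → g * h ∈ S) (g : D) : g ∈ S := by
  have hadd : ∀ a ∈ S, ∀ b, dist (ι a) (ι b) < δ → b ∈ S := by
    intro a ha b hab
    have h2 := hS a ha (a⁻¹ * b) (by
      rw [← dist_mul_left (ι a), dist_comm]
      simpa using hab)
    simpa using h2
  have hclopen : IsClopen (⋃ a ∈ S, Metric.ball (ι a) (δ / 2)) := by
    refine ⟨isClosed_of_closure_subset fun x hx => ?_, isOpen_biUnion fun _ _ => Metric.isOpen_ball⟩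
    obtain ⟨b, hb⟩ := hι.exists_dist_lt x (show 0 < δ / 4 by positivity)
    obtain ⟨y, hy, hxy⟩ := Metric.mem_closure_iff.1 hx (δ / 4) (by positivity)
    obtain ⟨a, ha, hya⟩ := Set.mem_iUnion₂.1 hy
    rw [Metric.mem_ball] at hya
    refine Set.mem_iUnion₂.2 ⟨b, hadd a ha b ?_, hb.trans (by linarith)⟩
    have h2 := dist_triangle4 (ι a) y x (ι b)
    rw [dist_comm (ι a) y, dist_comm y x] at h2
    linarith
  have huniv := hclopen.eq_univ ⟨ι 1, Set.mem_iUnion₂.2 ⟨1, h1, by simpa using hδ⟩⟩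
  obtain ⟨a, ha, hga⟩ := Set.mem_iUnion₂.1 (huniv ▸ Set.mem_univ (ι g))
  rw [Metric.mem_ball, dist_comm] at hga
  exact hadd a ha g (by linarith)

end Pulses

/-! ### Limits of the increments and the contradiction. -/

namespace BlockReduction

variable {G : Type*} [Group G] [MetricSpace G] [IsIsometricSMul G G] [IsIsometricSMul Gᵐᵒᵖ G]
variable {D : Type*} [Group D] {ι : D →* G} {F : ℕ → Set D}
variable {H : Type*} [Group H] [MetricSpace H] [IsIsometricSMul H H] [IsIsometricSMul Hᵐᵒᵖ H]
variable {K : Type*} [Group K] [MetricSpace K] [IsIsometricSMul K K] [IsIsometricSMul Kᵐᵒᵖ K]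

/-- In a strongly NSS quotient, the increments are asymptotically multiplicative. -/
theorem exists_forall_dist_σ_mul_lt [CompleteSpace G] (R : BlockReduction ι F H)
    (hF1 : ∀ j, (1 : D) ∈ F j) (hF : ∀ g, ∀ᶠ j in atTop, g ∈ F j) (π : H →* K)
    (hπ : Continuous π) (hK : IsStronglyNSS K) :
    ∃ δ > 0, ∀ g h, dist (ι h) 1 < δ → ∀ η > 0, ∃ N, ∀ p ≥ N, ∀ q > p,
      dist (π (R.σ p g) * π (R.σ q h)) (π (R.σ p (g * h))) < η := by
  obtain ⟨δ, hδ, hB⟩ := R.exists_forall_dist_prod_lt hF1 π hπ hK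
  refine ⟨δ, hδ, fun g h hh η hη => ?_⟩
  obtain ⟨N, hN⟩ := hB η hη
  obtain ⟨N', hN'⟩ := eventually_atTop.1 ((hF g).and ((hF h).and (hF (g * h))))
  refine ⟨max N N', fun p hp q hq => ?_⟩
  have hpN : N ≤ p := (le_max_left _ _).trans hp
  have hpN' : N' ≤ p := (le_max_right _ _).trans hp
  -- The quotient of `u` over `v` leaves `1` after `p`, by a distance `dist (ι h) 1`, and is `1`
  -- again after `q`.
  let u : ℕ → D := fun n => if n = p then g else if n = q then h else 1
  let v : ℕ → D := fun n => if n = p then g * h else 1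
  have hup : u p = g := if_pos rfl
  have huq : u q = h := (if_neg hq.ne').trans (if_pos rfl)
  have hvp : v p = g * h := if_pos rfl
  have hvq : v q = 1 := if_neg hq.ne'
  have hu : ∀ k, k ≠ p → k ≠ q → u k = 1 := fun k hk hk' => (if_neg hk).trans (if_neg hk')
  have hv : ∀ k, k ≠ p → k ≠ q → v k = 1 := fun k hk _ => if_neg hk
  have huF : ∀ k, u k ∈ F k := fun k => by
    rcases eq_or_ne k p with rfl | hk
    · exact hup ▸ (hN' k hpN').1
    rcases eq_or_ne k q with rfl | hk'
    · exact huq ▸ (hN' k (by omega)).2.1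
    · exact hu k hk hk' ▸ hF1 k
  have hvF : ∀ k, v k ∈ F k := fun k => by
    rcases eq_or_ne k p with rfl | hk
    · exact hvp ▸ (hN' k hpN').2.2
    · exact (show v k = 1 from if_neg hk) ▸ hF1 k
  obtain ⟨a1, a2, a3⟩ := seqProd_of_eq_one_of_ne (c := fun k => ι (u k)) hq
    fun k hk hk' => by rw [hu k hk hk', map_one]
  obtain ⟨b1, b2, b3⟩ := seqProd_of_eq_one_of_ne (c := fun k => ι (v k)) hq
    fun k hk hk' => by rw [hv k hk hk', map_one]
  obtain ⟨c1, c2, c3⟩ := seqProd_of_eq_one_of_ne (c := fun k => R.σ k (u k)) hq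
    fun k hk hk' => by rw [hu k hk hk', R.σ_one]
  obtain ⟨d1, d2, d3⟩ := seqProd_of_eq_one_of_ne (c := fun k => R.σ k (v k)) hq
    fun k hk hk' => by rw [hv k hk hk', R.σ_one]
  have hqN : quotProd (fun k => ι (u k)) (fun k => ι (v k)) N = 1 := by
    rw [quotProd, a1 N hpN, b1 N hpN, inv_one, mul_one]
  have hqq : quotProd (fun k => ι (u k)) (fun k => ι (v k)) (q + 1) = 1 := by
    rw [quotProd, a3, b3, hup, huq, hvp, hvq]
    simp
  have h1 := hN u v huF hvF (q + 1) (by omega) (fun n hn hn' => by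
    rw [hqN]
    rcases le_or_gt n p with hnp | hnp
    · rw [quotProd, a1 n hnp, b1 n hnp]
      simpa using hδ
    rcases Nat.le_succ_iff.1 hn' with hnq | rfl
    · rw [quotProd, a2 n hnp hnq, b2 n hnp hnq, hup, hvp, dist_mul_inv_one, dist_comm, map_mul,
        dist_mul_left_self]
      exact hh
    · rw [hqq, dist_self]
      exact hδ) (by rw [hqN, hqq])
  simp only [prod_eq_seqProd] at h1
  rw [c3, d3, c1 N hpN, d1 N hpN, hup, huq, hvp, hvq, R.σ_one] at h1
  simpa [dist_mul_inv_one] using h1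

/-- In a strongly NSS quotient, the increments converge to a map that is multiplicative at small
elements. -/
theorem exists_tendsto_σ [CompleteSpace G] [CompleteSpace K] [PreconnectedSpace G]
    (R : BlockReduction ι F H) (hι : DenseRange ι) (hF1 : ∀ j, (1 : D) ∈ F j)
    (hF : ∀ g, ∀ᶠ j in atTop, g ∈ F j) (π : H →* K) (hπ : Continuous π) (hK : IsStronglyNSS K) :
    ∃ s : D → K, (∀ g, Tendsto (fun p => π (R.σ p g)) atTop (𝓝 (s g))) ∧
      ∃ δ > 0, ∀ g h, dist (ι h) 1 < δ → s (g * h) = s g * s h := by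
  obtain ⟨δ, hδ, hC⟩ := R.exists_forall_dist_σ_mul_lt hF1 hF π hπ hK
  have hsmall : ∀ h, dist (ι h) 1 < δ → ∃ b, Tendsto (fun p => π (R.σ p h)) atTop (𝓝 b) := by
    intro h hh
    refine cauchySeq_tendsto_of_complete (Metric.cauchySeq_iff'.2 fun ε hε => ?_)
    -- For `g = 1` the estimate compares the increments of `h` at two places, which is the Cauchy
    -- property.
    obtain ⟨N, hN⟩ := hC 1 h hh ε hε
    refine ⟨N, fun n hn => ?_⟩
    rcases hn.eq_or_lt with rfl | hn
    · simpa using hε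
    · simpa [R.σ_one] using hN N le_rfl n hn
  have hmul : ∀ g h a b, dist (ι h) 1 < δ → Tendsto (fun p => π (R.σ p g)) atTop (𝓝 a) →
      Tendsto (fun p => π (R.σ p h)) atTop (𝓝 b) →
        Tendsto (fun p => π (R.σ p (g * h))) atTop (𝓝 (a * b)) := by
    intro g h a b hh ha hb
    rw [Metric.tendsto_atTop]
    intro ε hε
    obtain ⟨N, hN⟩ := hC g h hh (ε / 2) (by positivity)
    obtain ⟨N₁, hN₁⟩ := Metric.tendsto_atTop.1 ha (ε / 4) (by positivity)
    obtain ⟨N₂, hN₂⟩ := Metric.tendsto_atTop.1 hb (ε / 4) (by positivity)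
    refine ⟨max N N₁, fun p hp => ?_⟩
    set q := max (p + 1) N₂
    have h1 := hN p ((le_max_left _ _).trans hp) q (Nat.lt_of_succ_le (le_max_left _ _))
    have h2 := dist_mul_mul_le_add (π (R.σ p g)) (π (R.σ q h)) a b
    have h3 := hN₁ p ((le_max_right _ _).trans hp)
    have h4 := hN₂ q (le_max_right _ _)
    have h5 := dist_triangle_left (π (R.σ p (g * h))) (a * b) (π (R.σ p g) * π (R.σ q h))
    linarith
  have hall : ∀ g, ∃ a, Tendsto (fun p => π (R.σ p g)) atTop (𝓝 a) :=
    mem_of_forall_mul_mem (S := {g | ∃ a, Tendsto (fun p => π (R.σ p g)) atTop (𝓝 a)}) hι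
      (hsmall 1 (by simpa using hδ)) hδ fun g ⟨a, ha⟩ h hh => by
        obtain ⟨b, hb⟩ := hsmall h hh
        exact ⟨_, hmul g h a b hh ha hb⟩
  choose s hs using hall
  exact ⟨s, hs, δ, hδ, fun g h hh =>
    tendsto_nhds_unique (hs _) (hmul g h _ _ hh (hs g) (hs h))⟩

/-- Uniform continuity, applied to a single increment `h` and the trivial sequence. -/
theorem exists_forall_dist_τ_le [CompleteSpace G] (R : BlockReduction ι F H)
    (hF1 : ∀ j, (1 : D) ∈ F j) {ε : ℝ} (hε : 0 < ε) :
    ∃ N, ∃ δ > 0, ∀ h, dist (ι h) 1 < δ → ∀ j ≥ N, h ∈ F j →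
      ∀ l ∈ Set.Icc (R.M j) (R.M (j + 1)), dist (R.τ j h l) 1 ≤ ε := by
  obtain ⟨N, δ, hδ, hA⟩ := R.exists_forall_dist_val_le hε
  refine ⟨N, δ, hδ, fun h hh j hj hhj l hl => ?_⟩
  let u : ℕ → D := fun n => if n = j then h else 1
  have hu : ∀ k, k ≠ j → u k = 1 := fun k hk => if_neg hk
  have huj : u j = h := if_pos rfl
  have huF : ∀ k, u k ∈ F k := fun k => by
    rcases eq_or_ne k j with rfl | hk
    · exact huj ▸ hhj
    · exact hu k hk ▸ hF1 k
  have h1 : ∀ n, seqProd (fun _ => ι (1 : D)) n = 1 := fun n =>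
    seqProd_eq_of_eq_one (Nat.zero_le n) fun _ _ _ => map_one ι
  have h2 : ∀ n ≤ j, seqProd (fun k => ι (u k)) n = 1 := fun n hn =>
    seqProd_eq_of_eq_one (Nat.zero_le n) fun k _ hk => by rw [hu k (by omega), map_one]
  have h3 : ∀ n ≤ j, R.prod u n = 1 := fun n hn =>
    seqProd_eq_of_eq_one (Nat.zero_le n) fun k _ hk => by rw [hu k (by omega)]; exact R.σ_one k
  have h4 : ∀ n, R.prod (fun _ => 1) n = 1 := fun n =>
    seqProd_eq_of_eq_one (Nat.zero_le n) fun k _ hk => R.σ_one k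
  have h5 := hA u (fun _ => 1) huF hF1 j hj (fun n hn hn' => by
    rw [quotProd, quotProd, h1, h1, h2 N hj]
    rcases Nat.le_succ_iff.1 hn' with hnj | rfl
    · simpa [h2 n hnj] using hδ
    · simpa [seqProd_succ, h2 j le_rfl, huj] using hh) l hl
  rw [h3 N hj, h4, val, val, ← prod, ← prod, h3 j le_rfl, h4, huj, R.τ_one] at h5
  simpa using h5

/-- If `H` is a totally disconnected closed subgroup of a product of strongly NSS groups, then
the increments at a fixed element tend to `1`. -/
theorem tendsto_σ_one [CompleteSpace G] [PreconnectedSpace G] [TotallyDisconnectedSpace H]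
    (R : BlockReduction ι F H) (hι : DenseRange ι) (hF1 : ∀ j, (1 : D) ∈ F j)
    (hF : ∀ g, ∀ᶠ j in atTop, g ∈ F j) {I : Type*} {K : I → Type*} [∀ i, Group (K i)]
    [∀ i, MetricSpace (K i)] [∀ i, IsIsometricSMul (K i) (K i)]
    [∀ i, IsIsometricSMul (K i)ᵐᵒᵖ (K i)] [∀ i, CompleteSpace (K i)]
    (hK : ∀ i, IsStronglyNSS (K i)) (π : ∀ i, H →* K i)
    (hπ : IsClosedEmbedding fun h i => π i h) (g : D) :
    Tendsto (fun p => R.σ p g) atTop (𝓝 1) := by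
  have hπc : ∀ i, Continuous (π i) := fun i => (continuous_apply i).comp hπ.continuous
  have hlim := fun i => R.exists_tendsto_σ hι hF1 hF (π i) (hπc i) (hK i)
  choose s hs δ hδ hmul using hlim
  have hs1 : ∀ i, s i 1 = 1 := fun i => by
    refine tendsto_nhds_unique (hs i 1) ?_
    simp [R.σ_one]
  have hext : ∀ i, ∃ S : G → K i, Continuous S ∧ ∀ g, S (ι g) = s i g := by
    intro i
    -- Only a pseudometric, as `ι` need not be injective. Near-multiplicativity and small blocks at
    -- small elements make `s i` uniformly continuous, so it extends to `G`.
    let _ : PseudoMetricSpace D := PseudoMetricSpace.induced ι inferInstance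
    have hι' : IsUniformInducing ι := ⟨rfl⟩
    have huc : UniformContinuous (s i) := by
      rw [Metric.uniformContinuous_iff]
      intro ε hε
      obtain ⟨ρ, hρ, hρ'⟩ := Metric.continuousAt_iff.1 ((hπc i).continuousAt (x := 1)) (ε / 2)
        (by positivity)
      obtain ⟨N, δ', hδ', hτ⟩ := R.exists_forall_dist_τ_le hF1 (half_pos hρ)
      refine ⟨min δ' (δ i), lt_min hδ' (hδ i), fun a b hab => ?_⟩
      have hab' : dist (ι (a⁻¹ * b)) 1 < min δ' (δ i) := by
        rw [← dist_mul_left (ι a), dist_comm, ← map_mul, mul_inv_cancel_left, mul_one]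
        exact hab
      have h1 := hmul i a (a⁻¹ * b) (hab'.trans_le (min_le_right _ _))
      rw [mul_inv_cancel_left] at h1
      rw [h1, dist_comm, dist_mul_left_self]
      refine lt_of_le_of_lt (le_of_tendsto ((hs i (a⁻¹ * b)).dist tendsto_const_nhds) ?_)
        (half_lt_self hε)
      filter_upwards [hF (a⁻¹ * b), eventually_ge_atTop N] with j hj hNj
      have h2 := hτ _ (hab'.trans_le (min_le_left _ _)) j hNj hj _ (R.last_mem j)
      have h3 := hρ' (h2.trans_lt (half_lt_self hρ))
      rw [map_one] at h3
      exact h3.le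
    refine ⟨(hι'.isDenseInducing hι).extend (s i),
      (uniformContinuous_uniformly_extend hι' hι huc).continuous, fun a => ?_⟩
    exact uniformly_extend_of_ind hι' hι huc a
  choose S hSc hS using hext
  have hSc' : Continuous fun x i => S i x := continuous_pi hSc
  have hlim' : ∀ a, Tendsto (fun p i => π i (R.σ p a)) atTop (𝓝 fun i => S i (ι a)) := fun a =>
    tendsto_pi_nhds.2 fun i => by
      rw [hS]
      exact hs i a
  -- Closedness of the image of `H` keeps the limits inside it, so the maps `S i` lift to a
  -- continuous map to `H`.
  have hrange : ∀ x, (fun i => S i x) ∈ Set.range fun (h : H) i => π i h := by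
    intro x
    refine hι.induction_on (p := fun x => (fun i => S i x) ∈ Set.range fun (h : H) i => π i h) x
      (hπ.isClosed_range.preimage hSc') fun a => ?_
    exact hπ.isClosed_range.mem_of_tendsto (hlim' a) (Eventually.of_forall fun p => ⟨_, rfl⟩)
  choose T hT using hrange
  have hTc : Continuous T := by
    rw [hπ.isInducing.continuous_iff]
    exact hSc'.congr fun x => (hT x).symm
  have hTconst : T (ι g) = T (ι 1) :=
    (isPreconnected_univ.image T hTc.continuousOn).subsingleton (Set.mem_image_of_mem T trivial)
      (Set.mem_image_of_mem T trivial)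
  rw [hπ.isInducing.tendsto_nhds_iff]
  refine (hlim' g).trans_eq ?_
  congr 1
  rw [← hT, hTconst, hT]
  funext i
  rw [hS, hs1, map_one]

/-- A block reduction of a nontrivial connected group cannot have increments that tend to `1`. -/
theorem exists_not_tendsto_σ_one [CompleteSpace G] [CompleteSpace H] [PreconnectedSpace G]
    [Nontrivial G] (R : BlockReduction ι F H) (hι : DenseRange ι) (hF1 : ∀ j, (1 : D) ∈ F j)
    (hF : ∀ g, ∀ᶠ j in atTop, g ∈ F j) :
    ∃ g, ¬ Tendsto (fun p => R.σ p g) atTop (𝓝 1) := by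
  by_contra! hσ
  obtain ⟨g, hg⟩ : ∃ g, ι g ≠ 1 := by
    by_contra! h
    obtain ⟨x, hx⟩ := exists_ne (1 : G)
    exact hx (hι.induction_on (p := fun x => x = 1) x isClosed_singleton h)
  -- `ε` comes before `g`: it fixes how small the factors of `g` must be. `ε'` is met afterwards, by
  -- placing the factors far enough out.
  have hblock : ∀ ε > 0, ∀ g, ∀ ε' > 0, ∀ N, ∃ m > N, ∃ u : ℕ → D, (∀ n, u n ∈ F n) ∧
      seqProd (fun k => ι (u k)) m = seqProd (fun k => ι (u k)) N * ι g ∧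
      (∀ j, N ≤ j → j ≤ m → dist (R.prod u j) (R.prod u N) < ε') ∧
      ∀ j, N ≤ j → j < m → ∀ l ∈ Set.Icc (R.M j) (R.M (j + 1)), dist (R.τ j (u j) l) 1 ≤ ε := by
    intro ε hε
    obtain ⟨N₀, δ, hδ, hτ⟩ := R.exists_forall_dist_τ_le hF1 hε
    refine mem_of_forall_mul_mem (S := {g | ∀ ε' > 0, ∀ N, ∃ m > N, ∃ u : ℕ → D,
      (∀ n, u n ∈ F n) ∧ seqProd (fun k => ι (u k)) m = seqProd (fun k => ι (u k)) N * ι g ∧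
      (∀ j, N ≤ j → j ≤ m → dist (R.prod u j) (R.prod u N) < ε') ∧
      ∀ j, N ≤ j → j < m → ∀ l ∈ Set.Icc (R.M j) (R.M (j + 1)), dist (R.τ j (u j) l) 1 ≤ ε})
      hι ?_ hδ ?_
    · intro ε' hε' N
      refine ⟨N + 1, Nat.lt_succ_self N, fun _ => 1, hF1, ?_, fun j hj hj' => ?_,
        fun j _ _ l _ => ?_⟩
      · simp [seqProd_succ]
      · rw [prod_eq_seqProd, prod_eq_seqProd, seqProd_eq_of_eq_one hj fun k _ _ => R.σ_one k]
        simpa using hε'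
      · simpa [R.τ_one] using hε.le
    · intro a ha b hb ε' hε' N
      obtain ⟨m, hm, u, hu, h1, h2, h3⟩ := ha (ε' / 2) (by positivity) N
      obtain ⟨p, hpF, hpσ, hpN, hpm⟩ := ((hF b).and ((Metric.tendsto_nhds.1 (hσ b) (ε' / 2)
        (by positivity)).and ((eventually_ge_atTop N₀).and (eventually_ge_atTop m)))).exists
      let v : ℕ → D := fun n => if n < m then u n else if n = p then b else 1
      have hv1 : ∀ n < m, v n = u n := fun n hn => if_pos hn
      have hvp : v p = b := (if_neg (by omega)).trans (if_pos rfl)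
      have hv2 : ∀ n ≥ m, n ≠ p → v n = 1 := fun n hn hn' =>
        (if_neg (by omega)).trans (if_neg hn')
      have hι1 : ∀ n ≤ m, seqProd (fun k => ι (v k)) n = seqProd (fun k => ι (u k)) n :=
        fun n hn => seqProd_congr fun k hk => by rw [hv1 k (by omega)]
      have hσ1 : ∀ n ≤ m, R.prod v n = R.prod u n :=
        fun n hn => seqProd_congr fun k hk => by rw [hv1 k (by omega)]
      have hι2 : ∀ n, m ≤ n → n ≤ p → seqProd (fun k => ι (v k)) n =
          seqProd (fun k => ι (v k)) m := fun n hn hn' =>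
        seqProd_eq_of_eq_one hn fun k hk hk' => by rw [hv2 k hk (by omega), map_one]
      have hσ2 : ∀ n, m ≤ n → n ≤ p → R.prod v n = R.prod v m := fun n hn hn' =>
        seqProd_eq_of_eq_one hn fun k hk hk' => by
          rw [hv2 k hk (by omega)]
          exact R.σ_one k
      refine ⟨p + 1, by omega, v, fun n => ?_, ?_, fun j hj hj' => ?_, fun j hj hj' l hl => ?_⟩
      · rcases lt_or_ge n m with hn | hn
        · exact hv1 n hn ▸ hu n
        rcases eq_or_ne n p with rfl | hn'
        · exact hvp ▸ hpF
        · exact hv2 n hn hn' ▸ hF1 n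
      · rw [seqProd_succ, hι2 p hpm le_rfl, hι1 m le_rfl, h1, hι1 N hm.le, hvp, map_mul, mul_assoc]
      · have hm' : dist (R.prod u m) (R.prod u N) < ε' / 2 := h2 m hm.le le_rfl
        rw [hσ1 N hm.le]
        rcases le_total j m with hjm | hjm
        · rw [hσ1 j hjm]
          exact (h2 j hj hjm).trans (half_lt_self hε')
        rcases Nat.le_succ_iff.1 hj' with hjp | rfl
        · rw [hσ2 j hjm hjp, hσ1 m le_rfl]
          exact hm'.trans (half_lt_self hε')
        · rw [prod_succ, hσ2 p hpm le_rfl, hσ1 m le_rfl, hvp]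
          have h4 := dist_triangle (R.prod u m * R.σ p b) (R.prod u m) (R.prod u N)
          rw [dist_mul_left_self] at h4
          linarith
      · rcases lt_or_ge j m with hn | hn
        · rw [hv1 j hn]
          exact h3 j hj hn l hl
        rcases eq_or_ne j p with rfl | hn'
        · rw [hvp]
          exact hτ b hb j hpN hpF l hl
        · rw [hv2 j hn hn', R.τ_one, dist_self]
          exact hε.le
  obtain ⟨N, hN, hN0, u, -, hu⟩ := exists_glued (1 : D)
    (fun k N m u => N ≤ m ∧ (∀ n, N ≤ n → n < m → u n ∈ F n) ∧
      (seqProd (fun k => ι (u k)) N)⁻¹ * seqProd (fun k => ι (u k)) m = ι g ∧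
      (∀ j, N ≤ j → j ≤ m → dist ((R.prod u N)⁻¹ * R.prod u j) 1 ≤ (1 / 2) ^ k) ∧
      ∀ j, N ≤ j → j < m → ∀ l ∈ Set.Icc (R.M j) (R.M (j + 1)),
        dist (R.τ j (u j) l) 1 ≤ (1 / 2) ^ k)
    (by
      rintro k N m u v huv ⟨hNm, h1, h2, h3, h4⟩
      refine ⟨hNm, fun n hn hn' => huv n hn hn' ▸ h1 n hn hn', ?_, fun j hj hj' => ?_,
        fun j hj hj' => huv j hj hj' ▸ h4 j hj hj'⟩
      · rw [← h2]
        exact (seqProd_inv_mul_congr hNm fun i hi hi' => by rw [huv i hi hi']).symm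
      · rw [← R.inv_mul_prod_congr hj fun i hi hi' => huv i hi (by omega)]
        exact h3 j hj hj')
    (by
      intro k N
      obtain ⟨m, hm, u, hu, h1, h2, h3⟩ := hblock ((1 / 2) ^ k) (by positivity) g ((1 / 2) ^ k)
        (by positivity) N
      refine ⟨m, hm, u, hm.le, fun n _ _ => hu n, by rw [h1, inv_mul_cancel_left],
        fun j hj hj' => ?_, h3⟩
      rw [← dist_mul_left (R.prod u N), mul_inv_cancel_left, mul_one]
      exact (h2 j hj hj').le) 0
  have huF : ∀ n, u n ∈ F n := fun n => by
    obtain ⟨h1, h2⟩ := exists_block hN (n := n) (by omega)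
    exact (hu _).2.1 n h1 h2
  have hd : ∀ k n, N k ≤ n → n ≤ N (k + 1) →
      dist (R.prod u n) (R.prod u (N k)) ≤ (1 / 2) ^ k := fun k n hn hn' => by
    have h1 := (hu k).2.2.2.1 n hn hn'
    rwa [← dist_mul_left (R.prod u (N k)), mul_inv_cancel_left, mul_one] at h1
  obtain ⟨a, ha⟩ := exists_tendsto_of_blocks hN hd
  have hone : ∀ n, R.prod (fun _ => 1) n = 1 := fun n =>
    seqProd_eq_of_eq_one (Nat.zero_le n) fun k _ _ => R.σ_one k
  -- Against the trivial sequence the output converges, so the partial products in `G` would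
  -- converge although each block moves them by `ι g`.
  obtain ⟨b, hb⟩ := (R.reduces u (fun _ => 1) huF hF1).2 (by
    refine ⟨a, fun ε hε => ?_⟩
    have h0 : Tendsto (fun k : ℕ => ((1 : ℝ) / 2) ^ k) atTop (𝓝 0) :=
      tendsto_pow_atTop_nhds_zero_of_lt_one (by norm_num) (by norm_num)
    obtain ⟨k, hk⟩ := eventually_atTop.1 (h0.eventually
      (gt_mem_nhds (show (0 : ℝ) < ε / 2 by positivity)))
    obtain ⟨J, hJ⟩ := Metric.tendsto_atTop.1 ha (ε / 2) (by positivity)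
    refine ⟨max J (N k), fun j hj l hl => ?_⟩
    have h1 := hJ j ((le_max_left _ _).trans hj)
    obtain ⟨h2, h3⟩ := exists_block hN (n := j) (by omega)
    have h4 := (hu _).2.2.2.2 j h2 h3 l hl
    have h5 := hk _ (le_blockIndex hN ((le_max_right _ _).trans hj))
    change dist (R.prod u j * R.τ j (u j) l * (R.prod (fun _ => 1) j * R.τ j 1 l)⁻¹) a < ε
    rw [hone, R.τ_one, mul_one, inv_one, mul_one]
    have h6 := dist_triangle (R.prod u j * R.τ j (u j) l) (R.prod u j) a
    rw [dist_mul_left_self] at h6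
    linarith)
  have h1 : ∀ n, seqProd (fun _ => ι (1 : D)) n = 1 := fun n =>
    seqProd_eq_of_eq_one (Nat.zero_le n) fun _ _ _ => map_one ι
  have hb' : Tendsto (fun k => seqProd (fun k => ι (u k)) (N k)) atTop (𝓝 b) := by
    refine (hb.comp hN.tendsto_atTop).congr fun k => ?_
    simp only [Function.comp_apply, quotProd, h1, inv_one, mul_one]
  have h2 := (hb'.comp (tendsto_add_atTop_nat 1)).dist hb'
  simp only [dist_self, Function.comp_apply] at h2
  have h3 : ∀ k, dist (seqProd (fun k => ι (u k)) (N (k + 1))) (seqProd (fun k => ι (u k)) (N k)) =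
      dist (ι g) 1 := fun k => by
    rw [← (hu k).2.2.1, ← dist_mul_left (seqProd (fun k => ι (u k)) (N k)) (_ * _),
      mul_inv_cancel_left, mul_one]
  simp only [h3] at h2
  exact hg (dist_eq_zero.1 (tendsto_nhds_unique tendsto_const_nhds h2))

end BlockReduction

/-! ### Permanence of two-sided invariance. -/

section TSI

/-- Each summand of the product metric depends only on the distance in one coordinate. -/
theorem IsTSI.pi {ι : Type*} [Countable ι] {K : ι → Type*} [∀ i, Group (K i)]
    [t : ∀ i, TopologicalSpace (K i)] (hK : ∀ i, IsTSI (K i)) : IsTSI (∀ i, K i) := by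
  choose m hm hl hr using hK
  obtain rfl : t = fun i => (m i).toPseudoMetricSpace.toUniformSpace.toTopologicalSpace :=
    funext fun i => (hm i).symm
  let _ := Encodable.ofCountable ι
  refine ⟨PiCountable.metricSpace, rfl, fun g h k => ?_, fun g h k => ?_⟩
  · exact tsum_congr fun i => congrArg _ (hl i (g i) (h i) (k i))
  · exact tsum_congr fun i => congrArg _ (hr i (g i) (h i) (k i))

theorem IsTSI.subgroup {G : Type*} [Group G] [t : TopologicalSpace G] (hG : IsTSI G)
    (H : Subgroup G) : IsTSI H := by
  obtain ⟨m, rfl, hl, hr⟩ := hG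
  exact ⟨inferInstance, rfl, fun g h k => hl g h k, fun g h k => hr g h k⟩

theorem isIsometricSMul_of_dist {G : Type*} [Group G] [MetricSpace G]
    (h : ∀ g h k : G, dist (g * h) (g * k) = dist h k) : IsIsometricSMul G G :=
  ⟨fun c => Isometry.of_dist_eq (h c)⟩

theorem isIsometricSMul_op_of_dist {G : Type*} [Group G] [MetricSpace G]
    (h : ∀ g h k : G, dist (h * g) (k * g) = dist h k) : IsIsometricSMul Gᵐᵒᵖ G :=
  ⟨fun c => Isometry.of_dist_eq (h c.unop)⟩

theorem borel_measurable_comp {X Y Z : Type*} [TopologicalSpace X] [TopologicalSpace Y]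
    [TopologicalSpace Z] {f : Y → Z} {g : X → Y}
    (hf : @Measurable Y Z (borel Y) (borel Z) f) (hg : Continuous g) :
    @Measurable X Z (borel X) (borel Z) fun x => f (g x) :=
  hf.comp hg.borel_measurable

end TSI

/-! ### Reduction to the connected case and conclusion. -/

section Main

theorem BlockReduction.nonempty_of_borelReducible {G : Type*} [Group G] [TopologicalSpace G]
    [IsTopologicalGroup G] {H : Type*} [Group H] [MetricSpace H] [IsTopologicalGroup H]
    [IsIsometricSMul H H] [IsIsometricSMul Hᵐᵒᵖ H] [SecondCountableTopology H] [CompleteSpace H]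
    (h : BorelReducible (inducedEquiv G) (inducedEquiv H)) {D : Type*} [Group D] [Countable D]
    (ι : D →* G) {F : ℕ → Set D} (hF : ∀ j, (F j).Finite) (hF1 : ∀ j, (1 : D) ∈ F j) :
    Nonempty (BlockReduction ι F H) := by
  obtain ⟨f, hfm, hf⟩ := h
  refine nonempty_blockReduction ι hF hF1 (fun x => f fun n => ι (x n)) (fun _ _ => ?_)
    fun x y => hf _ _
  exact borel_measurable_comp hfm (continuous_pi fun n =>
    continuous_of_discreteTopology.comp (continuous_apply n))

theorem not_borelReducible_of_preconnected {G : Type*} [Group G] [tG : TopologicalSpace G]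
    [IsTopologicalGroup G] [PolishSpace G] [PreconnectedSpace G] [Nontrivial G] (hG : IsTSI G)
    {H : Type*} [Group H] [tH : TopologicalSpace H] [IsTopologicalGroup H] [PolishSpace H]
    [TotallyDisconnectedSpace H] (hH : IsTSI H) {I : Type*} {K : I → Type*} [∀ i, Group (K i)]
    [tK : ∀ i, TopologicalSpace (K i)] [∀ i, IsTopologicalGroup (K i)] [∀ i, PolishSpace (K i)]
    (hK : ∀ i, IsTSI (K i)) (hK' : ∀ i, IsStronglyNSS (K i)) (π : ∀ i, H →* K i)
    (hπ : IsClosedEmbedding fun h i => π i h) :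
    ¬ BorelReducible (inducedEquiv G) (inducedEquiv H) := by
  intro hred
  obtain ⟨mG, rfl, hGl, hGr⟩ := hG
  obtain ⟨mH, rfl, hHl, hHr⟩ := hH
  choose mK hmK hKl hKr using hK
  obtain rfl : tK = fun i => (mK i).toPseudoMetricSpace.toUniformSpace.toTopologicalSpace :=
    funext fun i => (hmK i).symm
  have := isIsometricSMul_of_dist hGl
  have := isIsometricSMul_op_of_dist hGr
  have := isIsometricSMul_of_dist hHl
  have := isIsometricSMul_op_of_dist hHr
  have := fun i => isIsometricSMul_of_dist (hKl i)
  have := fun i => isIsometricSMul_op_of_dist (hKr i)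
  have : CompleteSpace G := completeSpace_of_biInvariant
  have : CompleteSpace H := completeSpace_of_biInvariant
  have : ∀ i, CompleteSpace (K i) := fun i => completeSpace_of_biInvariant
  -- A countable group with dense image; with the discrete topology, `ι` is continuous.
  let ι : FreeGroup ℕ →* G := FreeGroup.lift (TopologicalSpace.denseSeq G)
  have hι : DenseRange ι := by
    refine (TopologicalSpace.denseRange_denseSeq G).mono ?_
    rintro _ ⟨n, rfl⟩
    exact ⟨FreeGroup.of n, FreeGroup.lift_apply_of⟩
  obtain ⟨e, he⟩ := Countable.exists_injective_nat (FreeGroup ℕ)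
  let F : ℕ → Set (FreeGroup ℕ) := fun j => insert 1 {g | e g ≤ j}
  have hF : ∀ j, (F j).Finite := fun j =>
    ((Set.finite_Iic j).preimage he.injOn).insert 1
  have hF1 : ∀ j, 1 ∈ F j := fun j => Set.mem_insert _ _
  have hFe : ∀ g, ∀ᶠ j in atTop, g ∈ F j := fun g =>
    (eventually_ge_atTop (e g)).mono fun j hj => Set.mem_insert_of_mem _ hj
  obtain ⟨R⟩ := BlockReduction.nonempty_of_borelReducible hred ι hF hF1
  obtain ⟨g, hg⟩ := R.exists_not_tendsto_σ_one hι hF1 hFe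
  exact hg (R.tendsto_σ_one hι hF1 hFe hK' π hπ g)

/-- Inclusion of sequences reduces `E(S)` to `E(G)`: since `S` is closed, limits in `G` of quotients
from `S` stay in `S`. -/
theorem BorelReducible.comp_subgroup {G : Type*} [Group G] [TopologicalSpace G]
    [IsTopologicalGroup G] {Y : Type*} [TopologicalSpace Y] {E : Setoid Y} (S : Subgroup G)
    (hS : IsClosed (S : Set G)) (h : BorelReducible (inducedEquiv G) E) :
    BorelReducible (inducedEquiv S) E := by
  obtain ⟨f, hfm, hf⟩ := h
  refine ⟨fun x => f fun n => x n, borel_measurable_comp hfm (continuous_pi fun n =>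
    continuous_subtype_val.comp (continuous_apply n)), fun x y => Iff.trans ?_ (hf _ _)⟩
  constructor
  · rintro ⟨a, ha⟩
    exact ⟨a, (continuous_subtype_val.tendsto a).comp ha⟩
  · rintro ⟨a, ha⟩
    have hmem : a ∈ S := hS.mem_of_tendsto ha
      (Eventually.of_forall fun n => S.mul_mem (x n).2 (S.inv_mem (y n).2))
    exact ⟨⟨a, hmem⟩, tendsto_subtype_rng.2 ha⟩

/-- A preconnected set with two points can be translated to contain `1`. -/
theorem nontrivial_connectedComponentOfOne {G : Type*} [Group G] [TopologicalSpace G]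
    [IsTopologicalGroup G] (h : ¬ TotallyDisconnectedSpace G) :
    Nontrivial (Subgroup.connectedComponentOfOne G) := by
  by_contra hn
  rw [not_nontrivial_iff_subsingleton] at hn
  refine h ⟨fun s _ hs x hx y hy => ?_⟩
  have h1 : IsPreconnected ((fun z => x⁻¹ * z) '' s) :=
    hs.image _ (continuous_const.mul continuous_id).continuousOn
  have h2 := h1.subset_connectedComponent ⟨x, hx, inv_mul_cancel x⟩
  have h3 : x⁻¹ * y ∈ Subgroup.connectedComponentOfOne G := h2 ⟨y, hy, rfl⟩
  have h4 : (⟨x⁻¹ * y, h3⟩ : Subgroup.connectedComponentOfOne G) = 1 := Subsingleton.elim _ _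
  exact (inv_mul_eq_one.1 (congrArg Subtype.val h4))

end Main

theorem corollary6
    {G : Type*} [Group G] [TopologicalSpace G] [IsTopologicalGroup G] [PolishSpace G]
    (hG : IsTSI G)
    {ι : Type*} [Countable ι] {K : ι → Type*} [∀ i, Group (K i)] [∀ i, TopologicalSpace (K i)]
    [∀ i, IsTopologicalGroup (K i)] [∀ i, PolishSpace (K i)]
    (hK : ∀ i, IsTSI (K i)) (hK' : ∀ i, IsStronglyNSS (K i))
    (H : Subgroup (∀ i, K i)) (hH : IsClosed (H : Set (∀ i, K i)))
    (hHtd : TotallyDisconnectedSpace H) (hGtd : ¬ TotallyDisconnectedSpace G) :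
    ¬ BorelReducible (inducedEquiv G) (inducedEquiv H) := by
  intro hred
  have hcl : IsClosed (Subgroup.connectedComponentOfOne G : Set G) := isClosed_connectedComponent
  have : PolishSpace (Subgroup.connectedComponentOfOne G) := hcl.polishSpace
  have : PolishSpace H := hH.polishSpace
  have : PreconnectedSpace (Subgroup.connectedComponentOfOne G) :=
    isPreconnected_iff_preconnectedSpace.1 isPreconnected_connectedComponent
  have := nontrivial_connectedComponentOfOne hGtd
  exact not_borelReducible_of_preconnected (hG.subgroup _) ((IsTSI.pi hK).subgroup H) hK hK'
    (fun i => (Pi.evalMonoidHom K i).comp H.subtype) hH.isClosedEmbedding_subtypeVal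
    (hred.comp_subgroup _ hcl)
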